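/- **Setting.** Let $\mathcal X$ be a measurable space and $\mathcal Y$ a countable (discrete) set. A stochastic policy $h$ is a Markov kernel from $\mathcal X$ to $\mathcal Y$; $h(y\mid x)$ is the probability it gives to $y$ on input $x$. Let $\Pr(X)$ be a probability distribution on $\mathcal X$, $h_0$ a stochastic policy (the logging policy), $\delta:\mathcal X\times\mathcal Y\to[-1,0]$ a measurable loss, $M>0$, and $\mathcal H$ a set of stochastic policies satisfying the following measurability condition: there is a family $(h_t)_{t\in T}$ of policies in $\mathcal H$, indexed by a standard Borel space $T$, with $(t,x)\mapsto h_t(y\mid x)$ jointly measurable for every $y$, such that every $h\in\mathcal H$ is a pointwise limit of a sequence from this family, i.e. $h_{t_k}(y\mid x)\to h(y\mid x)$ for all $x,y$. The risk of $h$ is $R(h)=\mathbb E_{x\sim\Pr(X)}\mathbb E_{y\sim h(x)}[\delta(x,y)]$. For $h\in\mathcal H$ put $$f_h(x,y)=1+\frac{\delta(x,y)}{M}\min\Big\{M,\frac{h(y\mid x)}{h_0(y\mid x)}\Big\},\qquad \mathcal F_{\mathcal H}=\{f_h:h\in\mathcal H\}$$ (the ratio is read as $0$ where $h_0(y\mid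 x)=0$). For $\epsilon>0$ and $A\subseteq\mathbb R^m$ let $\mathcal N(\epsilon,A,\|\cdot\|_\infty)$ be the smallest cardinality of a subset $A_0\subseteq A$ such that $A$ is contained in the union of the closed $\|\cdot\|_\infty$-balls of radius $\epsilon$ centred at points of $A_0$, and for a class $\mathcal F$ of real functions on $\mathcal X\times\mathcal Y$ let $$\mathcal N_\infty(\epsilon,\mathcal F,m)=\sup_{z\in(\mathcal X\times\mathcal Y)^m}\mathcal N\big(\epsilon,\{(f(z_1),\dots,f(z_m)):f\in\mathcal F\},\|\cdot\|_\infty\big).$$ Given a sample $(x_1,y_1),\dots,(x_n,y_n)$, write $$u_h^i=\delta(x_i,y_i)\min\Big\{M,\frac{h(y_i\mid x_i)}{h_0(y_i\mid x_i)}\Big\},\quad \hat R^M(h)=\overline{u_h}=\frac1n\sum_{i=1}^n u_h^i,\quad \mathrm{Var}_h(u)=\frac1{n-1}\sum_{i=1}^n(u_h^i-\overline{u_h})^2,$$ $$\mathcal Q_{\mathcal H}(n,\gamma)=\log\Big(\frac{10\,\mathcal N_\infty(\frac1n,\mathcal F_{\mathcal H},2n)}{\gamma}\Big).$$ **Theorem.**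 Let $n\ge 16$ and $0<\gamma<1$. Let $(x_1,y_1),\dots,(x_n,y_n)$ be i.i.d. with $x_i\sim\Pr(X)$ and $y_i\sim h_0(x_i)$ given $x_i$. Then there is a measurable event of probability at least $1-\gamma$ on which, simultaneously for all $h\in\mathcal H$, $$R(h)\le\hat R^M(h)+\sqrt{\frac{18\,\mathrm{Var}_h(u)\,\mathcal Q_{\mathcal H}(n,\gamma)}{n}}+M\,\frac{15\,\mathcal Q_{\mathcal H}(n,\gamma)}{n-1}.$$ -/

import Mathlib

open MeasureTheory ProbabilityTheory Filter Topology
open scoped NNReal ENNReal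

namespace CRM

noncomputable section

/-- The uniform covering number `N_∞(ε, F, m)`: the supremum over all `m`-point samples `z` of the
smallest cardinality of a subset of `F(z) = {(f (z 1), …, f (z m)) : f ∈ F} ⊆ ℝ^m` whose
sup-norm `ε`-balls cover `F(z)` (`Fin m → ℝ` carries the sup norm). -/
def unifCoveringNumber {Z : Type*} (ε : ℝ≥0) (F : Set (Z → ℝ)) (m : ℕ) : ℕ∞ :=
  ⨆ z : Fin m → Z,
    Metric.coveringNumber ε ((fun (f : Z → ℝ) (i : Fin m) => f (z i)) '' F)

variable {X Y : Type*} [MeasurableSpace X] [MeasurableSpace Y]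

/-- The probability `h(y ∣ x)` that the stochastic policy `h` assigns to `y` on input `x`. -/
def prob (h : Kernel X Y) (y : Y) (x : X) : ℝ := (h x).real {y}

/-- The risk `R(h) = E_{x ∼ μ} E_{y ∼ h(x)} [δ(x, y)]`. -/
def risk (μ : Measure X) (δ : X × Y → ℝ) (h : Kernel X Y) : ℝ :=
  ∫ x, ∫ y, δ (x, y) ∂(h x) ∂μ

/-- The clipped, importance-weighted loss `δ(x, y) · min {M, h(y ∣ x) / h₀(y ∣ x)}`.
At points with `h₀(y ∣ x) = 0`, which the logging policy never produces, the ratio is `0`. -/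
def clippedLoss (h₀ : Kernel X Y) (δ : X × Y → ℝ) (M : ℝ) (h : Kernel X Y) (z : X × Y) : ℝ :=
  δ z * min M (prob h z.2 z.1 / prob h₀ z.2 z.1)

/-- The function `f_h(x, y) = 1 + (δ(x, y) / M) · min {M, h(y ∣ x) / h₀(y ∣ x)}`. -/
def auxFun (h₀ : Kernel X Y) (δ : X × Y → ℝ) (M : ℝ) (h : Kernel X Y) (z : X × Y) : ℝ :=
  1 + δ z / M * min M (prob h z.2 z.1 / prob h₀ z.2 z.1)

/-- The auxiliary function class `F_H = {f_h : h ∈ H}`. -/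
def auxClass (h₀ : Kernel X Y) (δ : X × Y → ℝ) (M : ℝ) (H : Set (Kernel X Y)) :
    Set (X × Y → ℝ) :=
  auxFun h₀ δ M '' H

/-- The clipped inverse propensity scoring estimate `R̂^M(h)`, the mean of the clipped losses
`u_h^i` over the sample `s`. -/
def ipsEstimate (h₀ : Kernel X Y) (δ : X × Y → ℝ) (M : ℝ) {n : ℕ} (s : Fin n → X × Y)
    (h : Kernel X Y) : ℝ :=
  (∑ i, clippedLoss h₀ δ M h (s i)) / n

/-- The sample variance `Var_h(u) = ∑ i, (u_h^i - mean)² / (n - 1)` of the clipped losses. -/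
def sampleVar (h₀ : Kernel X Y) (δ : X × Y → ℝ) (M : ℝ) {n : ℕ} (s : Fin n → X × Y)
    (h : Kernel X Y) : ℝ :=
  (∑ i, (clippedLoss h₀ δ M h (s i) - ipsEstimate h₀ δ M s h) ^ 2) / ((n : ℝ) - 1)

/-- The capacity term `Q_H(n, γ) = log (10 · N_∞(1/n, F_H, 2n) / γ)`. For losses in `[-1, 0]`,
`M > 0` and `n > 0` the covering number is finite (`unifCoveringNumber_auxClass_ne_top`), so
that `ENat.toNat` does not change it. -/
def capacityLog (h₀ : Kernel X Y) (δ : X × Y → ℝ) (M : ℝ) (H : Set (Kernel X Y)) (n : ℕ)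
    (γ : ℝ) : ℝ :=
  Real.log
    (10 * ((unifCoveringNumber (1 / (n : ℝ≥0)) (auxClass h₀ δ M H) (2 * n)).toNat : ℝ) / γ)

/-- The measurability condition on the policy class: there is a family of policies in `H`, indexed
by a standard Borel space `T` and jointly measurable in the index and the input, such that every
policy in `H` is a pointwise limit of a sequence of members of the family. Every countable class,
every class with a jointly measurable standard Borel parametrization and every class that is
separable for pointwise convergence along sequences satisfies it. -/
def IsPermissible (H : Set (Kernel X Y)) : Prop :=
  ∃ (T : Type) (_ : MeasurableSpace T) (_ : StandardBorelSpace T) (κ : Kernel (T × X) Y),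
    (∀ t : T, ∃ h ∈ H, ∀ x : X, h x = κ (t, x)) ∧
    ∀ h ∈ H, ∃ t : ℕ → T, ∀ (x : X) (y : Y),
      Tendsto (fun k => (κ (t k, x)).real {y}) atTop (𝓝 ((h x).real {y}))

theorem auxFun_mem_Icc {h₀ h : Kernel X Y} {δ : X × Y → ℝ} {M : ℝ} (hM : 0 < M)
    (hδ : ∀ z, δ z ∈ Set.Icc (-1 : ℝ) 0) (z : X × Y) :
    auxFun h₀ δ M h z ∈ Set.Icc (0 : ℝ) 1 := by
  obtain ⟨h1, h2⟩ := hδ z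
  have hr : 0 ≤ prob h z.2 z.1 / prob h₀ z.2 z.1 :=
    div_nonneg measureReal_nonneg measureReal_nonneg
  set w := min M (prob h z.2 z.1 / prob h₀ z.2 z.1) with hw
  have hw0 : 0 ≤ w := le_min hM.le hr
  have hw1 : w / M ≤ 1 := (div_le_one hM).2 (min_le_left _ _)
  have hw2 : 0 ≤ w / M := by positivity
  have e : auxFun h₀ δ M h z = 1 + δ z * (w / M) := by
    rw [auxFun, ← hw]; ring
  rw [e]
  constructor <;> nlinarith

theorem unifCoveringNumber_auxClass_ne_top {h₀ : Kernel X Y} {H : Set (Kernel X Y)}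
    {δ : X × Y → ℝ} {M : ℝ} (hM : 0 < M) (hδ : ∀ z, δ z ∈ Set.Icc (-1 : ℝ) 0)
    {ε : ℝ≥0} (hε : 0 < ε) (m : ℕ) :
    unifCoveringNumber ε (auxClass h₀ δ M H) m ≠ ⊤ := by
  have hK : IsCompact (Set.Icc (0 : Fin m → ℝ) 1) := isCompact_Icc
  obtain ⟨C, hCs, hCf, hC⟩ :=
    Metric.exists_finite_isCover_of_isCompact (ε := ε / 2) (by positivity) hK
  have hle : Metric.coveringNumber (ε / 2) (Set.Icc (0 : Fin m → ℝ) 1) ≤ C.encard :=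
    hC.coveringNumber_le_encard hCs
  refine ne_top_of_le_ne_top (Set.encard_ne_top_iff.2 hCf) (iSup_le fun z => ?_)
  refine (Metric.coveringNumber_subset_le ?_).trans hle
  rintro _ ⟨_, ⟨h, -, rfl⟩, rfl⟩
  exact ⟨fun i => (auxFun_mem_Icc hM hδ (z i)).1, fun i => (auxFun_mem_Icc hM hδ (z i)).2⟩

end

end CRM

namespace CRM

/-! Clipping a nonpositive loss only raises its expectation, so the risk is at most `M * (E f_h -
1)` and it suffices to bound `E f_h` above by an empirical Bernstein inequality, uniformly over
functions with values in `[0, 1]` (`risk_le_of_integral_auxFun_le`).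

The uniform bound is proved by symmetrization. By Chebyshev, a ghost sample has probability at least
1/3 of a mean within its own empirical standard deviation scale of the expectation
(`one_third_le_measure_ghost`). A deviation on the first sample thus becomes, at the cost of a
factor 3, a gap between the halves of a double sample (`measure_exists_deviation_le`). Random swaps
within the pairs preserve the law of the double sample. With the pairs fixed, a finite cover
replaces the class, and three Rademacher tails control the gap of means (two signs) and the growth
of the squared deviations. Outside these tails the variance of the first half alone bounds the gap
(`pair_bounds`, `not_mem_badDouble`). The failure probability is at most `3 * N * 3 * exp (-t) =
9γ/10`.

The bad event is a projection along the index space and need not be measurable. Averaging over swaps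
is therefore applied to measurable subsets of nearly full outer measure, obtained from
capacitability of analytic sets (`exists_measurableSet_subset_image_snd`). The remaining policies
are pointwise limits of the parametrized ones. -/

/-! ### Capacitability of analytic sets and measurable projection. -/

/-- The set of sequences whose first `k` terms are bounded by those of `b`. -/
def boxPrefix (b : ℕ → ℕ) (k : ℕ) : Set (ℕ → ℕ) := {x | ∀ i < k, x i ≤ b i}

theorem boxPrefix_anti (b : ℕ → ℕ) {j k : ℕ} (h : j ≤ k) : boxPrefix b k ⊆ boxPrefix b j :=
  fun _ hx i hi => hx i (hi.trans_le h)

/-- Any bounds on the first coordinates can be prolonged with an arbitrarily small loss. -/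
theorem exists_bound_succ {α : Type*} [MeasurableSpace α] (ν : Measure α) [IsFiniteMeasure ν]
    (f : (ℕ → ℕ) → α) (S : Set (ℕ → ℕ)) (k : ℕ) {c : ℝ≥0∞} (hc : c < ν (f '' S)) :
    ∃ N : ℕ, c < ν (f '' (S ∩ {x | x k ≤ N})) := by
  have hU : f '' S = ⋃ N : ℕ, f '' (S ∩ {x | x k ≤ N}) := by
    rw [← Set.image_iUnion, ← Set.inter_iUnion]
    congr 1
    refine (Set.inter_eq_left.2 fun x _ => Set.mem_iUnion.2 ⟨x k, le_refl (x k)⟩).symm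
  have hmono : Monotone fun N : ℕ => f '' (S ∩ {x | x k ≤ N}) := fun a b hab =>
    Set.image_mono (Set.inter_subset_inter_right _ fun x (hx : x k ≤ a) => le_trans hx hab)
  -- Continuity from below along increasing unions holds for outer measure, so the images need not
  -- be measurable.
  rw [hU, hmono.measure_iUnion] at hc
  exact lt_iSup_iff.1 hc

/-- Bounding one coordinate at a time keeps the strict inequality at every finite stage. Only the
non-strict one survives in the limit over all coordinates. -/
theorem exists_bounds {α : Type*} [MeasurableSpace α] (ν : Measure α) [IsFiniteMeasure ν]
    (f : (ℕ → ℕ) → α) {c : ℝ≥0∞} (hc : c < ν (Set.range f)) :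
    ∃ b : ℕ → ℕ, ∀ k, c < ν (f '' boxPrefix b k) := by
  classical
  have hstep : ∀ (S : {S : Set (ℕ → ℕ) // c < ν (f '' S)}) (k : ℕ),
      ∃ N : ℕ, c < ν (f '' (S.1 ∩ {x | x k ≤ N})) := fun S k => exists_bound_succ ν f S.1 k S.2
  choose N hN using hstep
  let S : ℕ → {S : Set (ℕ → ℕ) // c < ν (f '' S)} := fun k =>
    Nat.rec ⟨Set.univ, by rwa [Set.image_univ]⟩ (fun k S => ⟨S.1 ∩ {x | x k ≤ N S k}, hN S k⟩) k
  refine ⟨fun k => N (S k) k, fun k => ?_⟩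
  have : (S k).1 = boxPrefix (fun k => N (S k) k) k := by
    induction k with
    | zero => ext x; simp [S, boxPrefix]
    | succ k ih =>
      have : (S (k + 1)).1 = (S k).1 ∩ {x | x k ≤ N (S k) k} := rfl
      rw [this, ih]
      ext x
      simp only [boxPrefix, Set.mem_inter_iff, Set.mem_ofPred_eq, Nat.lt_succ_iff_lt_or_eq]
      constructor
      · rintro ⟨h1, h2⟩ i (hi | rfl)
        exacts [h1 i hi, h2]
      · exact fun h => ⟨fun i hi => h i (Or.inl hi), h k (Or.inr rfl)⟩
  rw [← this]
  exact (S k).2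

/-- The image of a compact box is the intersection of the closures of the images of its
prefix boxes. -/
theorem iInter_closure_image_boxPrefix_subset {α : Type*} [TopologicalSpace α] [T2Space α]
    [RegularSpace α] {f : (ℕ → ℕ) → α} (hf : Continuous f) (b : ℕ → ℕ) :
    ⋂ k, closure (f '' boxPrefix b k) ⊆ f '' {x | ∀ i, x i ≤ b i} := by
  intro y hy
  by_contra hne
  have hK : IsCompact {x : ℕ → ℕ | ∀ i, x i ≤ b i} := by
    have : {x : ℕ → ℕ | ∀ i, x i ≤ b i} = Set.univ.pi fun i => Set.Iic (b i) := by
      ext; simp [Pi.le_def]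
    rw [this]
    exact isCompact_univ_pi fun i => (Set.finite_Iic _).isCompact
  have hcl : IsClosed (f '' {x | ∀ i, x i ≤ b i}) := (hK.image hf).isClosed
  obtain ⟨V, hV, hVc, hVsub⟩ : ∃ V ∈ 𝓝 y, IsClosed V ∧ V ⊆ (f '' {x | ∀ i, x i ≤ b i})ᶜ := by
    obtain ⟨V, ⟨h1, h2⟩, h3⟩ := (closed_nhds_basis y).mem_iff.1 (hcl.isOpen_compl.mem_nhds hne)
    exact ⟨V, h1, h2, h3⟩
  have hx : ∀ k, ∃ x ∈ boxPrefix b k, f x ∈ V := by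
    intro k
    have := mem_closure_iff_nhds.1 (Set.mem_iInter.1 hy k) V hV
    obtain ⟨_, hzV, x, hx, rfl⟩ := this
    exact ⟨x, hx, hzV⟩
  choose x hxb hxV using hx
  -- Truncation moves the points into the compact box. Each coordinate is eventually unchanged, so a
  -- convergent subsequence of the truncations has the same limit as the original points.
  let z : ℕ → ℕ → ℕ := fun k i => min (x k i) (b i)
  obtain ⟨w, hw, φ, hφ, hlim⟩ := hK.tendsto_subseq (x := z) fun k i => min_le_right _ _
  have hlim' : Tendsto (x ∘ φ) atTop (𝓝 w) := by
    rw [tendsto_pi_nhds] at hlim ⊢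
    intro i
    refine (hlim i).congr' ?_
    filter_upwards [eventually_gt_atTop i] with k hk
    exact min_eq_left (hxb (φ k) i (hk.trans_le (hφ.id_le k)))
  have : f w ∈ V := hVc.mem_of_tendsto ((hf.tendsto w).comp hlim')
    (Eventually.of_forall fun k => hxV (φ k))
  exact hVsub this ⟨w, hw, rfl⟩

/-- Capacitability: analytic sets are inner regular for closed sets. -/
theorem exists_isClosed_subset_of_lt_analyticSet {α : Type*} [TopologicalSpace α] [T2Space α]
    [RegularSpace α] [MeasurableSpace α] [BorelSpace α] (ν : Measure α) [IsFiniteMeasure ν]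
    {A : Set α} (hA : AnalyticSet A) {c : ℝ≥0∞} (hc : c < ν A) :
    ∃ K ⊆ A, IsClosed K ∧ c ≤ ν K := by
  rw [AnalyticSet] at hA
  rcases hA with rfl | ⟨f, hf, rfl⟩
  · simp at hc
  obtain ⟨b, hb⟩ := exists_bounds ν f hc
  refine ⟨⋂ k, closure (f '' boxPrefix b k),
    (iInter_closure_image_boxPrefix_subset hf b).trans (Set.image_subset_range _ _),
    isClosed_iInter fun _ => isClosed_closure, ?_⟩
  have hanti : Antitone fun k => closure (f '' boxPrefix b k) := fun j k hjk =>
    closure_mono (Set.image_mono (boxPrefix_anti b hjk))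
  rw [hanti.measure_iInter (fun k => isClosed_closure.measurableSet.nullMeasurableSet)
    ⟨0, measure_ne_top _ _⟩]
  exact le_iInf fun k => (hb k).le.trans (measure_mono subset_closure)

/-- A measurable subset of a product depends on the second factor only through countably many
measurable sets. -/
theorem exists_preimage_prodMap_of_measurableSet {T Ω : Type*} [MeasurableSpace T]
    [MeasurableSpace Ω] {D : Set (T × Ω)} (hD : MeasurableSet D) :
    ∃ (g : Ω → ℕ → Bool) (D' : Set (T × (ℕ → Bool))), Measurable g ∧ MeasurableSet D' ∧
      D = Prod.map id g ⁻¹' D' := by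
  classical
  rw [← generateFrom_prod] at hD
  induction D, hD using MeasurableSpace.generateFrom_induction with
  | hC D hD _ =>
    obtain ⟨A, hA, B, hB, rfl⟩ := hD
    refine ⟨fun ω _ => decide (ω ∈ B), A ×ˢ ((fun x : ℕ → Bool => x 0) ⁻¹' {true}),
      measurable_pi_lambda _ fun _ => ?_, ?_, ?_⟩
    · exact measurable_to_bool (by simpa [Set.preimage] using hB)
    · exact MeasurableSet.prod hA
        (measurable_pi_apply (X := fun _ : ℕ => Bool) 0 (measurableSet_singleton true))
    · ext ⟨t, ω⟩; simp
  | empty => exact ⟨fun _ _ => true, ∅, measurable_const, .empty, by simp⟩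
  | compl D _ ih =>
    obtain ⟨g, D', hg, hD', rfl⟩ := ih
    exact ⟨g, D'ᶜ, hg, hD'.compl, by simp⟩
  | iUnion D _ ih =>
    choose g D' hg hD' hDD using ih
    -- Countably many binary codes are interleaved into one through the pairing function.
    refine ⟨fun ω k => g k.unpair.1 ω k.unpair.2,
      ⋃ n, Prod.map id (fun x k => x (Nat.pair n k)) ⁻¹' D' n, ?_, ?_, ?_⟩
    · exact measurable_pi_lambda _ fun k => (measurable_pi_apply _).comp (hg _)
    · refine MeasurableSet.iUnion fun n => (measurable_id.prodMap ?_) (hD' n)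
      exact measurable_pi_lambda _ fun k => measurable_pi_apply _
    · rw [Set.preimage_iUnion]
      refine Set.iUnion_congr fun n => ?_
      conv_lhs => rw [hDD n]
      ext ⟨t, ω⟩
      simp

/-- Measurable projection theorem: the projection of a measurable set along a standard Borel space
has measurable subsets of almost full outer measure. -/
theorem exists_measurableSet_subset_image_snd {T Ω : Type*} [MeasurableSpace T]
    [StandardBorelSpace T] [MeasurableSpace Ω] (ν : Measure Ω) [IsFiniteMeasure ν]
    {D : Set (T × Ω)} (hD : MeasurableSet D) {c : ℝ≥0∞} (hc : c < ν (Prod.snd '' D)) :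
    ∃ K ⊆ Prod.snd '' D, MeasurableSet K ∧ c ≤ ν K := by
  obtain ⟨g, D', hg, hD', rfl⟩ := exists_preimage_prodMap_of_measurableSet hD
  have himg : Prod.snd '' (Prod.map id g ⁻¹' D') = g ⁻¹' (Prod.snd '' D') := by
    ext ω
    simp
  rw [himg] at hc ⊢
  have hA : AnalyticSet (Prod.snd '' D') := hD'.analyticSet_image measurable_snd
  -- The projection `Prod.snd '' D'` is only analytic; for such a set the inequality between the
  -- outer measures still follows from a measurable hull.
  have hc' : c < ν.map g (Prod.snd '' D') := hc.trans_le (by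
    rw [← measure_toMeasurable (μ := ν.map g), Measure.map_apply hg (measurableSet_toMeasurable _ _)]
    exact measure_mono (Set.preimage_mono (subset_toMeasurable _ _)))
  obtain ⟨K, hK, hKc, hcK⟩ := exists_isClosed_subset_of_lt_analyticSet (ν.map g) hA hc'
  refine ⟨g ⁻¹' K, Set.preimage_mono hK, hg hKc.measurableSet, ?_⟩
  rwa [Measure.map_apply hg hKc.measurableSet] at hcK

/-! ### Hoeffding's bound for Rademacher sums. -/

/-- The sign `-1` for `true` and `1` for `false`. -/
noncomputable def boolSign (b : Bool) : ℝ := if b then -1 else 1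

/-- The sum over sign patterns factorizes into a product of terms `2 cosh x`, and `cosh x ≤ exp (x²
/ 2)`. -/
theorem sum_exp_boolSign_le {ι : Type*} [Fintype ι] [DecidableEq ι] (d : ι → ℝ) (l : ℝ) :
    ∑ σ : ι → Bool, Real.exp (l * ∑ i, boolSign (σ i) * d i) ≤
      2 ^ Fintype.card ι * Real.exp (l ^ 2 * (∑ i, d i ^ 2) / 2) := by
  have h1 : ∀ σ : ι → Bool, Real.exp (l * ∑ i, boolSign (σ i) * d i) =
      ∏ i, Real.exp (l * (boolSign (σ i) * d i)) := fun σ => by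
    rw [← Real.exp_sum, Finset.mul_sum]
  simp_rw [h1]
  rw [← Fintype.prod_sum (fun i (b : Bool) => Real.exp (l * (boolSign b * d i)))]
  have h2 : (2 : ℝ) ^ Fintype.card ι * Real.exp (l ^ 2 * (∑ i, d i ^ 2) / 2) =
      ∏ i, (2 * Real.exp ((l * d i) ^ 2 / 2)) := by
    rw [Finset.prod_mul_distrib, ← Real.exp_sum]
    simp only [Finset.prod_const, Finset.card_univ]
    congr 2
    rw [Finset.mul_sum, Finset.sum_div]
    exact Finset.sum_congr rfl fun i _ => by ring
  rw [h2]
  refine Finset.prod_le_prod (fun i _ => Finset.sum_nonneg fun _ _ => (Real.exp_pos _).le)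
    fun i _ => ?_
  have h3 := Real.cosh_le_exp_half_sq (l * d i)
  rw [Real.cosh_eq] at h3
  simp only [Fintype.sum_bool, boolSign, if_true, Bool.false_eq_true, if_false]
  have e1 : l * (-1 * d i) = -(l * d i) := by ring
  have e2 : l * (1 * d i) = l * d i := by ring
  rw [e1, e2]
  linarith

/-- Hoeffding's inequality for Rademacher sums, as a count of sign patterns. -/
theorem card_boolSign_sum_gt_le {ι : Type*} [Fintype ι] [DecidableEq ι] (d : ι → ℝ) {t : ℝ}
    (ht : 0 < t) :
    ((Finset.univ.filter fun σ : ι → Bool =>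
        √(2 * (∑ i, d i ^ 2) * t) < ∑ i, boolSign (σ i) * d i).card : ℝ) ≤
      2 ^ Fintype.card ι * Real.exp (-t) := by
  set D := ∑ i, d i ^ 2 with hD
  have hD0 : 0 ≤ D := Finset.sum_nonneg fun i _ => sq_nonneg _
  rcases hD0.eq_or_lt with h0 | hpos
  · have hd : ∀ i, d i = 0 := fun i => by
      have := (Finset.sum_eq_zero_iff_of_nonneg fun i _ => sq_nonneg (d i)).1 h0.symm i
        (Finset.mem_univ i)
      simpa using this
    simp only [hd, mul_zero, Finset.sum_const_zero]
    -- When all coefficients vanish, the strict inequality in the tail event makes it empty.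
    rw [Finset.filter_false_of_mem fun σ _ => not_lt.2 (Real.sqrt_nonneg _)]
    simp only [Finset.card_empty, Nat.cast_zero]
    positivity
  -- The optimal exponent in the Chernoff bound: `l² D / 2 = t` while `l √(2 D t) = 2 t`.
  · set l := √(2 * t / D) with hl
    have hl2 : l ^ 2 = 2 * t / D := Real.sq_sqrt (by positivity)
    have hlpos : 0 < l := Real.sqrt_pos.2 (by positivity)
    have hls : l * √(2 * D * t) = 2 * t := by
      rw [hl, ← Real.sqrt_mul (by positivity)]
      have : 2 * t / D * (2 * D * t) = (2 * t) ^ 2 := by field_simp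
      rw [this, Real.sqrt_sq (by positivity)]
    have hmgf := sum_exp_boolSign_le d l
    rw [← hD, hl2] at hmgf
    have e1 : 2 * t / D * D / 2 = t := by field_simp
    rw [e1] at hmgf
    set A := Finset.univ.filter fun σ : ι → Bool =>
        √(2 * D * t) < ∑ i, boolSign (σ i) * d i
    have hlow : (A.card : ℝ) * Real.exp (2 * t) ≤
        ∑ σ : ι → Bool, Real.exp (l * ∑ i, boolSign (σ i) * d i) := by
      rw [← nsmul_eq_mul, ← Finset.sum_const]
      refine (Finset.sum_le_sum fun σ hσ => ?_).trans
        (Finset.sum_le_univ_sum_of_nonneg fun σ => (Real.exp_pos _).le)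
      rw [Real.exp_le_exp, ← hls]
      exact mul_le_mul_of_nonneg_left (Finset.mem_filter.1 hσ).2.le hlpos.le
    have e2 : Real.exp (2 * t) = Real.exp t * Real.exp t := by rw [← Real.exp_add]; ring_nf
    have hlow2 := hlow.trans hmgf
    rw [e2, ← mul_assoc] at hlow2
    have hlow3 := le_of_mul_le_mul_right hlow2 (Real.exp_pos t)
    rw [Real.exp_neg, ← div_eq_mul_inv, le_div_iff₀ (Real.exp_pos t)]
    exact hlow3

/-! ### Deterministic inequalities for means and variances. -/

section Deterministic

variable {n : ℕ}

/-- The mean of a finite sequence. -/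
noncomputable def mean (a : Fin n → ℝ) : ℝ := (∑ i, a i) / n

/-- The sum of squared deviations from the mean. -/
noncomputable def sumSqDev (a : Fin n → ℝ) : ℝ := ∑ i, (a i - mean a) ^ 2

theorem sumSqDev_nonneg (a : Fin n → ℝ) : 0 ≤ sumSqDev a :=
  Finset.sum_nonneg fun _ _ => sq_nonneg _

theorem sum_sub_sq_eq (hn : 0 < n) (a : Fin n → ℝ) (m : ℝ) :
    ∑ i, (a i - m) ^ 2 = sumSqDev a + n * (mean a - m) ^ 2 := by
  have hn' : (n : ℝ) ≠ 0 := by positivity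
  have hs : ∑ i, a i = n * mean a := by rw [mean]; field_simp
  have h : ∀ i, (a i - m) ^ 2 = (a i - mean a) ^ 2 + 2 * (mean a - m) * a i
      + (m ^ 2 - mean a ^ 2) := fun i => by ring
  simp_rw [h]
  rw [Finset.sum_add_distrib, Finset.sum_add_distrib, ← Finset.mul_sum, hs, sumSqDev]
  simp only [Finset.sum_const, Finset.card_univ, Fintype.card_fin, nsmul_eq_mul]
  ring

theorem sumSqDev_le_sum_sub_sq (hn : 0 < n) (a : Fin n → ℝ) (m : ℝ) :
    sumSqDev a ≤ ∑ i, (a i - m) ^ 2 := by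
  rw [sum_sub_sq_eq hn]
  have : (0 : ℝ) ≤ n * (mean a - m) ^ 2 := by positivity
  linarith

theorem mean_le_mean_add (hn : 0 < n) {a c : Fin n → ℝ} {e : ℝ} (h : ∀ i, |a i - c i| ≤ e) :
    mean a ≤ mean c + e := by
  have hn' : (0 : ℝ) < n := by positivity
  rw [mean, mean, div_add' _ _ _ hn'.ne']
  refine div_le_div_of_nonneg_right ?_ hn'.le
  have : ∑ i, a i ≤ ∑ i, (c i + e) :=
    Finset.sum_le_sum fun i _ => by linarith [(abs_le.1 (h i)).2]
  rw [Finset.sum_add_distrib] at this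
  simp only [Finset.sum_const, Finset.card_univ, Fintype.card_fin, nsmul_eq_mul] at this
  linarith

/-- This is the Euclidean triangle inequality: centring at the mean of `c` can only increase the
squared deviations of `a`, and Cauchy–Schwarz bounds the cross term. -/
theorem sqrt_sumSqDev_le (hn : 0 < n) {a c : Fin n → ℝ} {e : ℝ} (h : ∀ i, |a i - c i| ≤ e) :
    √(sumSqDev a) ≤ √(sumSqDev c) + √(n * e ^ 2) := by
  refine Real.sqrt_le_iff.2 ⟨by positivity, ?_⟩
  have h1 := sumSqDev_le_sum_sub_sq hn a (mean c)
  have h2 : ∑ i, (a i - mean c) ^ 2 = sumSqDev c + 2 * ∑ i, (c i - mean c) * (a i - c i)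
      + ∑ i, (a i - c i) ^ 2 := by
    rw [sumSqDev, Finset.mul_sum, ← Finset.sum_add_distrib, ← Finset.sum_add_distrib]
    exact Finset.sum_congr rfl fun i _ => by ring
  have h3 : ∑ i, (a i - c i) ^ 2 ≤ n * e ^ 2 := by
    have : ∑ i, (a i - c i) ^ 2 ≤ ∑ _i : Fin n, e ^ 2 :=
      Finset.sum_le_sum fun i _ => sq_le_sq.2 ((h i).trans (le_abs_self e))
    simpa using this
  have h4 := Real.sum_mul_le_sqrt_mul_sqrt Finset.univ (fun i => c i - mean c)
    (fun i => a i - c i)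
  have h5 : √(∑ i, (a i - c i) ^ 2) ≤ √(n * e ^ 2) := Real.sqrt_le_sqrt h3
  have h6 : √(∑ i, (c i - mean c) ^ 2) * √(∑ i, (a i - c i) ^ 2) ≤
      √(sumSqDev c) * √(n * e ^ 2) := mul_le_mul_of_nonneg_left h5 (Real.sqrt_nonneg _)
  have h7 := Real.sq_sqrt (sumSqDev_nonneg c)
  have h8 : √(n * e ^ 2) ^ 2 = n * e ^ 2 := Real.sq_sqrt (by positivity)
  nlinarith

/-- A second moment form of the empirical Bernstein inequality: a deviation of the mean of order
`√(v / n)` is bounded by the empirical variance if that is not much smaller than `v`. -/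
theorem sub_mean_le_of_ghost (hn : 35 ≤ n) {a : Fin n → ℝ} {m v : ℝ} (hv : 0 ≤ v)
    (h1 : (mean a - m) ^ 2 ≤ 2 * v / n) (h2 : n * v - √(6 * (n * v)) ≤ ∑ i, (a i - m) ^ 2) :
    m - mean a ≤ (3.7 + 1.46 * √(sumSqDev a)) / n := by
  have hn' : (35 : ℝ) ≤ n := by exact_mod_cast hn
  rw [sum_sub_sq_eq (by omega)] at h2
  set r := √(n * v) with hr
  have hr2 : r ^ 2 = n * v := Real.sq_sqrt (by positivity)
  have hr0 : 0 ≤ r := Real.sqrt_nonneg _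
  set s := √(sumSqDev a) with hs
  have hs2 : s ^ 2 = sumSqDev a := Real.sq_sqrt (sumSqDev_nonneg a)
  have hs0 : 0 ≤ s := Real.sqrt_nonneg _
  have h6 : √(6 * (n * v)) ≤ 2.4495 * r := by
    rw [Real.sqrt_mul (by norm_num)]
    refine mul_le_mul_of_nonneg_right (Real.sqrt_le_iff.2 ⟨by norm_num, by norm_num⟩) hr0
  have h3 : (n : ℝ) * (mean a - m) ^ 2 ≤ 2 * v := by
    rw [le_div_iff₀ (by positivity)] at h1; linarith
  have h4 : 2 * v ≤ 2 / 35 * r ^ 2 := by rw [hr2]; nlinarith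
  have h5 : 33 / 35 * r ^ 2 - 2.4495 * r ≤ s ^ 2 := by rw [hs2]; linarith
  -- The quadratic `h5` has its root at most `2.4495 · 35/33 + √(35/33) s`. Multiplying this bound
  -- by `√2` yields the constants 3.7 and 1.46.
  have h7 : r ≤ 2.6 + 1.03 * s := by
    by_contra! hc
    nlinarith [mul_nonneg hs0 hr0]
  rw [le_div_iff₀ (by positivity)]
  have h8 : ((m - mean a) * n) ^ 2 ≤ (1.4143 * r) ^ 2 := by
    have : ((m - mean a) * n) ^ 2 = n * (n * (mean a - m) ^ 2) := by ring
    rw [this]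
    have : (n : ℝ) * (n * (mean a - m) ^ 2) ≤ n * (2 * v) :=
      mul_le_mul_of_nonneg_left h3 (by positivity)
    nlinarith
  have h9 := abs_le_of_sq_le_sq h8 (by positivity)
  linarith [le_abs_self ((m - mean a) * n)]

/-- The double samples on which the second half exceeds the first one by more than the
deviation bound. -/
def badDouble (n : ℕ) (t : ℝ) : Set (Fin n → ℝ × ℝ) :=
  {w | mean (fun i => (w i).1) + √(18 * (sumSqDev (fun i => (w i).1) / (n - 1)) * t / n)
      + 15 * t / (n - 1) <
    mean (fun i => (w i).2) + (3.7 + 1.46 * √(sumSqDev fun i => (w i).2)) / n}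

theorem measurableSet_badDouble (t : ℝ) : MeasurableSet (badDouble n t) := by
  unfold badDouble mean sumSqDev mean
  refine measurableSet_lt ?_ ?_ <;> fun_prop

/-- The midpoint of the two means of a double sample. -/
noncomputable def pooledMean (w : Fin n → ℝ × ℝ) : ℝ :=
  (mean (fun i => (w i).1) + mean (fun i => (w i).2)) / 2

/-- The differences of the pairs of a double sample. -/
def pairDiff (w : Fin n → ℝ × ℝ) (i : Fin n) : ℝ := (w i).2 - (w i).1

/-- The differences of the squared deviations from the pooled mean. -/
noncomputable def pairSqDiff (w : Fin n → ℝ × ℝ) (i : Fin n) : ℝ :=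
  ((w i).2 - pooledMean w) ^ 2 - ((w i).1 - pooledMean w) ^ 2

theorem mean_mem_Icc {a : Fin n → ℝ} (ha : ∀ i, a i ∈ Set.Icc (0 : ℝ) 1) :
    mean a ∈ Set.Icc (0 : ℝ) 1 := by
  refine ⟨div_nonneg (Finset.sum_nonneg fun i _ => (ha i).1) (by positivity), ?_⟩
  refine div_le_one_of_le₀ ?_ (by positivity)
  have : ∑ i, a i ≤ ∑ _i : Fin n, (1 : ℝ) := Finset.sum_le_sum fun i _ => (ha i).2
  simpa using this

/-- If the conclusion fails, both factors of `u * (13/15 u - 1.4143 r)` are large; the constants are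
rounded so that `1.52 * 1.3173 > 2`. -/
theorem le_of_quadratic_le {u r s : ℝ} (hr : 0 ≤ r) (hs : 0 ≤ s)
    (h : 13 / 15 * u ^ 2 - 1.4143 * u * r ≤ 2 * s ^ 2) : u ≤ 1.64 * r + 1.52 * s := by
  by_contra! hcon
  have h1 : 1.52 * s < u := by linarith
  have h2 : 1.3173 * s < 13 / 15 * u - 1.4143 * r := by linarith
  have h3 := mul_lt_mul'' h1 h2 (by positivity) (by positivity)
  linarith [sq_nonneg s]

/-- If the Rademacher deviations of a double sample are controlled, so is the variance of its
second half and the difference of its means. -/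
theorem pair_bounds (hn : 0 < n) {t : ℝ} (ht : 0 ≤ t) (htn : 15 * t ≤ n)
    {c : Fin n → ℝ × ℝ} (hc1 : ∀ i, (c i).1 ∈ Set.Icc (0 : ℝ) 1)
    (hc2 : ∀ i, (c i).2 ∈ Set.Icc (0 : ℝ) 1)
    (h1 : ∑ i, pairDiff c i ≤ √(2 * (∑ i, pairDiff c i ^ 2) * t))
    (h2 : -∑ i, pairDiff c i ≤ √(2 * (∑ i, pairDiff c i ^ 2) * t))
    (h3 : ∑ i, pairSqDiff c i ≤ √(2 * (∑ i, pairSqDiff c i ^ 2) * t)) :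
    n * (mean (fun i => (c i).2) - mean (fun i => (c i).1)) ≤
        3.28 * √t ^ 2 + 3.04 * √(sumSqDev fun i => (c i).1) * √t ∧
      √(sumSqDev fun i => (c i).2) ≤ 1.075 * √(sumSqDev fun i => (c i).1) + 1.66 * √t := by
  have hn' : (0 : ℝ) < n := by positivity
  set a := fun i => (c i).1 with ha
  set b := fun i => (c i).2 with hb
  set m := pooledMean c with hm
  have hmd : m = (mean a + mean b) / 2 := rfl
  have hA := mean_mem_Icc (a := a) hc1
  have hB := mean_mem_Icc (a := b) hc2
  set Δ := mean b - mean a with hΔ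
  set T := ∑ i, (a i - m) ^ 2 with hT
  set T' := ∑ i, (b i - m) ^ 2 with hT'
  have hTe : T = sumSqDev a + n * Δ ^ 2 / 4 := by
    rw [hT, sum_sub_sq_eq hn, hmd, hΔ]; ring
  have hTe' : T' = sumSqDev b + n * Δ ^ 2 / 4 := by
    rw [hT', sum_sub_sq_eq hn, hmd, hΔ]; ring
  have hT0 : 0 ≤ T := Finset.sum_nonneg fun _ _ => sq_nonneg _
  have hT0' : 0 ≤ T' := Finset.sum_nonneg fun _ _ => sq_nonneg _
  have hD : ∑ i, pairDiff c i ^ 2 ≤ 2 * (T + T') := by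
    rw [hT, hT', ← Finset.sum_add_distrib, Finset.mul_sum]
    refine Finset.sum_le_sum fun i _ => ?_
    have : pairDiff c i = b i - a i := rfl
    rw [this]
    nlinarith [sq_nonneg (a i + b i - 2 * m)]
  -- Squared deviations `p, q` lie in `[0, 1]`, so `(p - q)² ≤ p + q`. The variance of the squares
  -- is thus linear in the variance itself.
  have hDy : ∑ i, pairSqDiff c i ^ 2 ≤ T + T' := by
    rw [hT, hT', ← Finset.sum_add_distrib]
    refine Finset.sum_le_sum fun i _ => ?_
    have : pairSqDiff c i = (b i - m) ^ 2 - (a i - m) ^ 2 := rfl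
    rw [this]
    have hm0 : 0 ≤ m := by rw [hmd]; linarith [hA.1, hB.1]
    have hm1 : m ≤ 1 := by rw [hmd]; linarith [hA.2, hB.2]
    have q1 : (a i - m) ^ 2 ≤ 1 := (sq_le_one_iff_abs_le_one _).2
      (abs_le.2 ⟨by linarith [(hc1 i).1], by linarith [(hc1 i).2]⟩)
    have q2 : (b i - m) ^ 2 ≤ 1 := (sq_le_one_iff_abs_le_one _).2
      (abs_le.2 ⟨by linarith [(hc2 i).1], by linarith [(hc2 i).2]⟩)
    have q3 := sq_nonneg (a i - m)
    have q4 := sq_nonneg (b i - m)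
    nlinarith [mul_nonneg q3 q4, mul_nonneg q3 (sub_nonneg.2 q1), mul_nonneg q4 (sub_nonneg.2 q2)]
  have hsum : ∑ i, pairDiff c i = n * Δ := by
    have : ∑ i, pairDiff c i = ∑ i, b i - ∑ i, a i := by
      rw [← Finset.sum_sub_distrib]; rfl
    rw [this, hΔ, mean, mean]; field_simp
  have hsum2 : ∑ i, pairSqDiff c i = T' - T := by
    rw [hT, hT', ← Finset.sum_sub_distrib]; rfl
  rw [hsum] at h1 h2
  rw [hsum2] at h3
  set u := √(T + T') with hu
  have hu2 : u ^ 2 = T + T' := Real.sq_sqrt (by positivity)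
  have hu0 : 0 ≤ u := Real.sqrt_nonneg _
  set r := √t with hr
  have hr2 : r ^ 2 = t := Real.sq_sqrt ht
  have hr0 : 0 ≤ r := Real.sqrt_nonneg _
  have hb1 : √(2 * (∑ i, pairDiff c i ^ 2) * t) ≤ 2 * u * r := by
    refine Real.sqrt_le_iff.2 ⟨by positivity, ?_⟩
    have : (2 * u * r) ^ 2 = 4 * (T + T') * t := by rw [← hu2, ← hr2]; ring
    rw [this]
    exact mul_le_mul_of_nonneg_right (by linarith) ht
  have hb3 : √(2 * (∑ i, pairSqDiff c i ^ 2) * t) ≤ 1.4143 * u * r := by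
    refine Real.sqrt_le_iff.2 ⟨by positivity, ?_⟩
    have : (1.4143 * u * r) ^ 2 = 1.4143 ^ 2 * (T + T') * t := by rw [← hu2, ← hr2]; ring
    rw [this]
    refine mul_le_mul_of_nonneg_right ?_ ht
    have : 0 ≤ T + T' := by positivity
    nlinarith
  replace h1 := h1.trans hb1
  replace h2 := h2.trans hb1
  replace h3 := h3.trans hb3
  set s := √(sumSqDev a) with hs
  have hs2 : s ^ 2 = sumSqDev a := Real.sq_sqrt (sumSqDev_nonneg a)
  have hs0 : 0 ≤ s := Real.sqrt_nonneg _
  -- Here `15 t ≤ n` makes the squared gap of the means a small fraction of the total spread.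
  have hΔ2 : n * Δ ^ 2 / 4 ≤ u ^ 2 / 15 := by
    have q : (n * Δ) ^ 2 ≤ (2 * u * r) ^ 2 := sq_le_sq' (by linarith) h1
    have q2 : (2 * u * r) ^ 2 = 4 * u ^ 2 * t := by rw [← hr2]; ring
    rw [q2] at q
    have q3 : 4 * u ^ 2 * t ≤ 4 * u ^ 2 * (n / 15) :=
      mul_le_mul_of_nonneg_left (by linarith) (by positivity)
    have q4 : (n : ℝ) * (n * Δ ^ 2 / 4) ≤ n * (u ^ 2 / 15) := by
      have e1 : (n : ℝ) * (n * Δ ^ 2 / 4) = (n * Δ) ^ 2 / 4 := by ring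
      have e2 : (n : ℝ) * (u ^ 2 / 15) = 4 * u ^ 2 * (n / 15) / 4 := by ring
      rw [e1, e2]
      linarith
    exact le_of_mul_le_mul_left q4 hn'
  -- Write `u² = 2 T + (T' - T)`, with `T = s² + n Δ² / 4` and `T' - T` bounded by `h3`; the spread
  -- of both halves is then governed by `s`.
  have hkey : 13 / 15 * u ^ 2 - 1.4143 * u * r ≤ 2 * s ^ 2 := by
    rw [hs2]; linarith
  have hub : u ≤ 1.64 * r + 1.52 * s := le_of_quadratic_le hr0 hs0 hkey
  have hs' : √(sumSqDev b) ≤ 0.7072 * (u + 0.7072 * r) := by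
    refine Real.sqrt_le_iff.2 ⟨by positivity, ?_⟩
    have q1 : sumSqDev b ≤ T' := by
      rw [hTe']; have : 0 ≤ n * Δ ^ 2 / 4 := by positivity
      linarith
    have q2 : (0.7072 * (u + 0.7072 * r)) ^ 2 =
      0.7072 ^ 2 * u ^ 2 + 2 * 0.7072 ^ 3 * (u * r) + 0.7072 ^ 4 * r ^ 2 := by ring
    linarith [mul_nonneg hu0 hr0, sq_nonneg r, sq_nonneg u]
  constructor
  · linarith [mul_le_mul_of_nonneg_right hub hr0]
  · linarith

/-- The swap estimates hold for the cover point `c` and are transferred to `w`. An error `1/n` per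
coordinate costs `1/n` in each mean and `1/√n ≤ 0.2` in each root of the squared deviations. -/
theorem not_mem_badDouble (hn : 35 ≤ n) {t : ℝ} (ht : 9 / 4 ≤ t) (htn : 15 * t ≤ n)
    {w c : Fin n → ℝ × ℝ} (hc1 : ∀ i, (c i).1 ∈ Set.Icc (0 : ℝ) 1)
    (hc2 : ∀ i, (c i).2 ∈ Set.Icc (0 : ℝ) 1)
    (hw1 : ∀ i, |(w i).1 - (c i).1| ≤ 1 / n) (hw2 : ∀ i, |(w i).2 - (c i).2| ≤ 1 / n)
    (h1 : ∑ i, pairDiff c i ≤ √(2 * (∑ i, pairDiff c i ^ 2) * t))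
    (h2 : -∑ i, pairDiff c i ≤ √(2 * (∑ i, pairDiff c i ^ 2) * t))
    (h3 : ∑ i, pairSqDiff c i ≤ √(2 * (∑ i, pairSqDiff c i ^ 2) * t)) :
    w ∉ badDouble n t := by
  have hn0 : 0 < n := by omega
  have hn' : (35 : ℝ) ≤ n := by exact_mod_cast hn
  obtain ⟨k1, k2⟩ := pair_bounds hn0 (by linarith) htn hc1 hc2 h1 h2 h3
  set a := fun i => (c i).1
  set b := fun i => (c i).2
  have m1 : mean a ≤ mean (fun i => (w i).1) + 1 / n :=
    mean_le_mean_add hn0 fun i => by rw [abs_sub_comm]; exact hw1 i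
  have m2 : mean (fun i => (w i).2) ≤ mean b + 1 / n := mean_le_mean_add hn0 hw2
  have he : √(n * (1 / (n : ℝ)) ^ 2) ≤ 0.2 := by
    refine Real.sqrt_le_iff.2 ⟨by norm_num, ?_⟩
    have : (n : ℝ) * (1 / (n : ℝ)) ^ 2 = 1 / n := by field_simp
    rw [this, div_le_iff₀ (by positivity)]
    linarith
  have s1 : √(sumSqDev a) ≤ √(sumSqDev fun i => (w i).1) + 0.2 :=
    (sqrt_sumSqDev_le hn0 fun i => by rw [abs_sub_comm]; exact hw1 i).trans (by linarith)
  have s2 : √(sumSqDev fun i => (w i).2) ≤ √(sumSqDev b) + 0.2 :=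
    (sqrt_sumSqDev_le hn0 hw2).trans (by linarith)
  have hr2 : √t ^ 2 = t := Real.sq_sqrt (by linarith)
  have hr : 3 / 2 ≤ √t := Real.le_sqrt_of_sq_le (by linarith)
  rw [badDouble, Set.mem_ofPred_eq, not_lt]
  set s := √(sumSqDev fun i => (w i).1) with hs
  have hs0 : 0 ≤ s := Real.sqrt_nonneg _
  have hs2 : s ^ 2 = sumSqDev fun i => (w i).1 := Real.sq_sqrt (sumSqDev_nonneg _)
  set r := √t
  have l1 : 4.24 * s * r / n ≤
      -- The constant is `4.24 < √18`, and `(n - 1) n ≤ n²`.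
      √(18 * (sumSqDev (fun i => (w i).1) / (n - 1)) * t / n) := by
    refine Real.le_sqrt_of_sq_le ?_
    rw [← hs2, ← hr2]
    have e : 18 * (s ^ 2 / (n - 1)) * r ^ 2 / n = 18 * (s * r) ^ 2 / ((n - 1) * n) := by
      have : (n : ℝ) - 1 ≠ 0 := by linarith
      field_simp
    have e2 : (4.24 * s * r / n) ^ 2 = 4.24 ^ 2 * (s * r) ^ 2 / (n * n) := by
      field_simp
    rw [e, e2]
    refine div_le_div₀ (by positivity) ?_ (mul_pos (by linarith) (by linarith)) ?_
    · exact mul_le_mul_of_nonneg_right (by norm_num) (sq_nonneg _)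
    · exact mul_le_mul_of_nonneg_right (by linarith) (by linarith)
  have l2 : 15 * r ^ 2 / n ≤ 15 * t / (n - 1) := by
    rw [hr2]
    exact div_le_div_of_nonneg_left (by linarith) (by linarith) (by linarith)
  -- Since `r ≥ 3/2`, the ghost term in `s`, about `1.57 s`, fits in `(4.24 - 3.04) s r`, and the
  -- constants and linear terms in `r` fit in the remaining multiple of `r²`.
  have g : n * (mean b - mean a) + 2 + (3.7 + 1.46 * √(sumSqDev fun i => (w i).2)) ≤
      4.24 * s * r + 15 * r ^ 2 := by
    have q1 : √(sumSqDev a) * r ≤ (s + 0.2) * r := mul_le_mul_of_nonneg_right s1 (by linarith)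
    have q2 : s * (3 / 2) ≤ s * r := mul_le_mul_of_nonneg_left hr hs0
    nlinarith
  have g2 : mean b - mean a + 2 / n + (3.7 + 1.46 * √(sumSqDev fun i => (w i).2)) / n ≤
      4.24 * s * r / n + 15 * r ^ 2 / n := by
    have e : mean b - mean a = n * (mean b - mean a) / n := by field_simp
    rw [e, ← add_div, ← add_div, ← add_div]
    exact div_le_div_of_nonneg_right g (by linarith)
  have e3 : (2 : ℝ) / n = 1 / n + 1 / n := by ring
  linarith

end Deterministic

/-! ### Random swaps within a double sample. -/

section Swap

variable {n : ℕ}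

/-- Exchange the entries of the pairs of a double sample at the indices where `σ` is `true`. -/
def swapPairs {Z : Type*} (σ : Fin n → Bool) (w : Fin n → Z × Z) : Fin n → Z × Z :=
  fun i => if σ i then (w i).swap else w i

theorem pairDiff_swapPairs (σ : Fin n → Bool) (c : Fin n → ℝ × ℝ) (i : Fin n) :
    pairDiff (swapPairs σ c) i = boolSign (σ i) * pairDiff c i := by
  cases h : σ i <;> simp [pairDiff, swapPairs, boolSign, h]

/-- This invariance is the reason for centring at the pooled mean: a swap then only flips the sign
of the difference of squares, which makes it a Rademacher term. -/
theorem pooledMean_swapPairs (σ : Fin n → Bool) (c : Fin n → ℝ × ℝ) :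
    pooledMean (swapPairs σ c) = pooledMean c := by
  simp only [pooledMean, mean, ← add_div, ← Finset.sum_add_distrib]
  congr 2
  refine Finset.sum_congr rfl fun i _ => ?_
  cases h : σ i <;> simp [swapPairs, h, add_comm]

theorem pairSqDiff_swapPairs (σ : Fin n → Bool) (c : Fin n → ℝ × ℝ) (i : Fin n) :
    pairSqDiff (swapPairs σ c) i = boolSign (σ i) * pairSqDiff c i := by
  simp only [pairSqDiff, pooledMean_swapPairs]
  cases h : σ i <;> simp [swapPairs, boolSign, h]

theorem boolSign_sq (b : Bool) : boolSign b ^ 2 = 1 := by cases b <;> simp [boolSign]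

theorem swapPairs_map {Z W : Type*} (f : Z → W) (σ : Fin n → Bool) (w : Fin n → Z × Z) :
    (fun i => (f (swapPairs σ w i).1, f (swapPairs σ w i).2)) =
      swapPairs σ fun i => (f (w i).1, f (w i).2) := by
  funext i
  cases h : σ i <;> simp [swapPairs, h]

/-- The sign patterns for which the Rademacher sum of `d` is large. -/
noncomputable def signTail (d : Fin n → ℝ) (t : ℝ) : Finset (Fin n → Bool) :=
  Finset.univ.filter fun σ => √(2 * (∑ i, d i ^ 2) * t) < ∑ i, boolSign (σ i) * d i

/-- The sign patterns for which one of the Rademacher deviations of a double sample is large. -/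
noncomputable def deviatingSigns (c : Fin n → ℝ × ℝ) (t : ℝ) : Finset (Fin n → Bool) :=
  signTail (pairDiff c) t ∪ signTail (fun i => -pairDiff c i) t ∪ signTail (pairSqDiff c) t

theorem card_signTail_le (d : Fin n → ℝ) {t : ℝ} (ht : 0 < t) :
    ((signTail d t).card : ℝ) ≤ 2 ^ n * Real.exp (-t) := by
  have := card_boolSign_sum_gt_le d ht
  rwa [Fintype.card_fin] at this

theorem card_deviatingSigns_le (c : Fin n → ℝ × ℝ) {t : ℝ} (ht : 0 < t) :
    ((deviatingSigns c t).card : ℝ) ≤ 2 ^ n * (3 * Real.exp (-t)) := by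
  have h1 := card_signTail_le (pairDiff c) ht
  have h2 := card_signTail_le (fun i => -pairDiff c i) ht
  have h3 := card_signTail_le (pairSqDiff c) ht
  have h4 : (deviatingSigns c t).card ≤ _ := (Finset.card_union_le _ _).trans
    (Nat.add_le_add_right (Finset.card_union_le _ _) _)
  have h5 := Nat.cast_le (α := ℝ).2 h4
  push_cast at h5
  linarith

/-- Swapping preserves coordinatewise closeness and the range `[0, 1]`, so one cover of the
unswapped sample serves all sign patterns. -/
theorem swapPairs_notMem_badDouble (hn : 35 ≤ n) {t : ℝ} (ht : 9 / 4 ≤ t) (htn : 15 * t ≤ n)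
    {w c : Fin n → ℝ × ℝ} (hc1 : ∀ i, (c i).1 ∈ Set.Icc (0 : ℝ) 1)
    (hc2 : ∀ i, (c i).2 ∈ Set.Icc (0 : ℝ) 1)
    (hw1 : ∀ i, |(w i).1 - (c i).1| ≤ 1 / n) (hw2 : ∀ i, |(w i).2 - (c i).2| ≤ 1 / n)
    {σ : Fin n → Bool} (hσ : σ ∉ deviatingSigns c t) :
    swapPairs σ w ∉ badDouble n t := by
  simp only [deviatingSigns, signTail, Finset.mem_union, Finset.mem_filter, Finset.mem_univ, true_and,
    not_or, not_lt] at hσ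
  obtain ⟨⟨h1, h2⟩, h3⟩ := hσ
  have both : ∀ (p : ℝ → ℝ → Prop) (i : Fin n), p (w i).1 (c i).1 → p (w i).2 (c i).2 →
      p (swapPairs σ w i).1 (swapPairs σ c i).1 ∧ p (swapPairs σ w i).2 (swapPairs σ c i).2 := by
    intro p i h h'
    cases hs : σ i <;> simp [swapPairs, hs, h, h']
  refine not_mem_badDouble hn ht htn (c := swapPairs σ c)
    (fun i => (both (fun _ y => y ∈ Set.Icc (0 : ℝ) 1) i (hc1 i) (hc2 i)).1)
    (fun i => (both (fun _ y => y ∈ Set.Icc (0 : ℝ) 1) i (hc1 i) (hc2 i)).2)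
    (fun i => (both (fun x y => |x - y| ≤ 1 / n) i (hw1 i) (hw2 i)).1)
    (fun i => (both (fun x y => |x - y| ≤ 1 / n) i (hw1 i) (hw2 i)).2) ?_ ?_ ?_
  · simpa only [pairDiff_swapPairs, mul_pow, boolSign_sq, one_mul] using h1
  · simpa only [pairDiff_swapPairs, mul_pow, boolSign_sq, one_mul, neg_sq, mul_neg,
      Finset.sum_neg_distrib] using h2
  · simpa only [pairSqDiff_swapPairs, mul_pow, boolSign_sq, one_mul] using h3

variable {Z : Type*} [MeasurableSpace Z]

theorem measurePreserving_swapPairs (P : Measure Z) [SigmaFinite P] (σ : Fin n → Bool) :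
    MeasurePreserving (swapPairs (Z := Z) σ) (Measure.pi fun _ => P.prod P)
      (Measure.pi fun _ => P.prod P) := by
  refine measurePreserving_pi (fun _ : Fin n => P.prod P) (fun _ => P.prod P)
    (f := fun i z => if σ i then z.swap else z) fun i => ?_
  cases σ i
  · exact MeasurePreserving.id _
  · simpa using Measure.measurePreserving_swap

/-- A measurable set of double samples that contains few of the swaps of each double sample has
small probability. -/
theorem measure_le_of_card_swapPairs_le (P : Measure Z) [IsProbabilityMeasure P]
    {K : Set (Fin n → Z × Z)} (hK : MeasurableSet K) {B : ℝ}
    (h : ∀ z, ∃ S : Finset (Fin n → Bool), (∀ σ, swapPairs σ z ∈ K → σ ∈ S) ∧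
      (S.card : ℝ) ≤ 2 ^ n * B) :
    (Measure.pi fun _ : Fin n => P.prod P) K ≤ ENNReal.ofReal B := by
  classical
  set Q := Measure.pi fun _ : Fin n => P.prod P with hQ
  have h1 : ∀ σ : Fin n → Bool, Q K = ∫⁻ z, K.indicator (fun _ => (1 : ℝ≥0∞)) (swapPairs σ z) ∂Q := fun σ => by
    rw [(measurePreserving_swapPairs P σ).lintegral_comp (measurable_const.indicator hK),
      lintegral_indicator_const hK, one_mul]
  -- By invariance, `2 ^ n * Q K` is the expected number of swaps that land in `K`.
  have h2 : (2 : ℝ≥0∞) ^ n * Q K = ∫⁻ z, ∑ σ : Fin n → Bool, K.indicator (fun _ => (1 : ℝ≥0∞))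
      (swapPairs σ z) ∂Q := by
    have hm : ∀ σ ∈ Finset.univ, Measurable fun z : Fin n → Z × Z =>
        K.indicator (fun _ => (1 : ℝ≥0∞)) (swapPairs σ z) := fun σ _ =>
      (measurable_const.indicator hK).comp (measurePreserving_swapPairs P σ).measurable
    rw [lintegral_finsetSum _ hm, ← Finset.sum_congr rfl fun σ _ => h1 σ]
    simp
  have h3 : ∀ z, ∑ σ : Fin n → Bool, K.indicator (fun _ => (1 : ℝ≥0∞)) (swapPairs σ z) ≤
      2 ^ n * ENNReal.ofReal B := fun z => by
    obtain ⟨S, hS, hcard⟩ := h z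
    calc ∑ σ : Fin n → Bool, K.indicator (fun _ => (1 : ℝ≥0∞)) (swapPairs σ z)
        ≤ ∑ σ : Fin n → Bool, if σ ∈ S then 1 else 0 := by
          refine Finset.sum_le_sum fun σ _ => ?_
          by_cases hm : swapPairs σ z ∈ K
          · simp [hm, hS σ hm]
          · simp [hm]
      _ = ENNReal.ofReal S.card := by simp
      _ ≤ ENNReal.ofReal (2 ^ n * B) := ENNReal.ofReal_le_ofReal hcard
      _ = 2 ^ n * ENNReal.ofReal B := by
          rw [ENNReal.ofReal_mul (by positivity), ENNReal.ofReal_pow (by norm_num)]; simp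
  have h4 : (2 : ℝ≥0∞) ^ n * Q K ≤ 2 ^ n * ENNReal.ofReal B := by
    rw [h2]
    refine (lintegral_mono h3).trans ?_
    simp
  exact (ENNReal.mul_le_mul_iff_right (by simp) (by simp)).1 h4

/-- The symmetrized deviation bound for a parametrized class of functions. -/
theorem measure_exists_mem_badDouble_le (P : Measure Z) [IsProbabilityMeasure P] (hn : 35 ≤ n)
    {t : ℝ} (ht : 9 / 4 ≤ t) (htn : 15 * t ≤ n) {T : Type*} [MeasurableSpace T]
    [StandardBorelSpace T] {F : T → Z → ℝ} (hF : Measurable (Function.uncurry F)) {N : ℕ}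
    (hcov : ∀ z : Fin n → Z × Z, ∃ C : Finset (Fin n → ℝ × ℝ), C.card ≤ N ∧
      (∀ c ∈ C, ∀ i, (c i).1 ∈ Set.Icc (0 : ℝ) 1 ∧ (c i).2 ∈ Set.Icc (0 : ℝ) 1) ∧
      ∀ τ, ∃ c ∈ C, ∀ i, |F τ (z i).1 - (c i).1| ≤ 1 / n ∧ |F τ (z i).2 - (c i).2| ≤ 1 / n) :
    (Measure.pi fun _ : Fin n => P.prod P)
      {z | ∃ τ, (fun i => (F τ (z i).1, F τ (z i).2)) ∈ badDouble n t} ≤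
      ENNReal.ofReal (N * (3 * Real.exp (-t))) := by
  classical
  set D : Set (T × (Fin n → Z × Z)) :=
    (fun p i => (F p.1 (p.2 i).1, F p.1 (p.2 i).2)) ⁻¹' badDouble n t with hD
  have hDm : MeasurableSet D := by
    refine measurableSet_preimage (measurable_pi_lambda _ fun i => ?_) (measurableSet_badDouble t)
    have e1 : Measurable fun p : T × (Fin n → Z × Z) => (p.1, (p.2 i).1) := by fun_prop
    have e2 : Measurable fun p : T × (Fin n → Z × Z) => (p.1, (p.2 i).2) := by fun_prop
    exact (hF.comp e1).prodMk (hF.comp e2)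
  have hproj : {z : Fin n → Z × Z | ∃ τ, (fun i => (F τ (z i).1, F τ (z i).2)) ∈ badDouble n t} =
      Prod.snd '' D := by
    ext z
    simp [hD]
  rw [hproj]
  -- The set may be non-measurable, so its outer measure is bounded through measurable subsets that
  -- nearly exhaust it.
  refine le_of_forall_lt fun c hc => ?_
  obtain ⟨c', hcc', hc'⟩ := exists_between hc
  obtain ⟨K, hKD, hKm, hcK⟩ := exists_measurableSet_subset_image_snd _ hDm hc'
  refine hcc'.trans_le (hcK.trans (measure_le_of_card_swapPairs_le P hKm fun z => ?_))
  obtain ⟨C, hCN, hC01, hCcov⟩ := hcov z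
  refine ⟨C.biUnion fun c => deviatingSigns c t, fun σ hσ => ?_, ?_⟩
  · obtain ⟨⟨τ, z'⟩, hτ, hz'⟩ := hKD hσ
    simp only at hz'
    subst hz'
    simp only [hD, Set.mem_preimage] at hτ
    rw [swapPairs_map] at hτ
    obtain ⟨c, hcC, hc⟩ := hCcov τ
    refine Finset.mem_biUnion.2 ⟨c, hcC, ?_⟩
    by_contra hns
    exact swapPairs_notMem_badDouble hn ht htn (fun i => (hC01 c hcC i).1)
      (fun i => (hC01 c hcC i).2) (fun i => (hc i).1) (fun i => (hc i).2) hns hτ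
  · have h1 : ((C.biUnion fun c => deviatingSigns c t).card : ℝ) ≤
        ∑ c ∈ C, ((deviatingSigns c t).card : ℝ) := by
      exact_mod_cast Finset.card_biUnion_le
    refine h1.trans ((Finset.sum_le_sum fun c _ =>
      card_deviatingSigns_le c (by linarith : (0 : ℝ) < t)).trans ?_)
    rw [Finset.sum_const, nsmul_eq_mul]
    have : (C.card : ℝ) ≤ N := by exact_mod_cast hCN
    calc (C.card : ℝ) * (2 ^ n * (3 * Real.exp (-t)))
        ≤ N * (2 ^ n * (3 * Real.exp (-t))) := mul_le_mul_of_nonneg_right this (by positivity)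
      _ = 2 ^ n * (N * (3 * Real.exp (-t))) := by ring

end Swap

/-! ### Symmetrization by a ghost sample. -/

section Ghost

/-- Chebyshev's inequality with a threshold that may vanish. The strict inequality keeps it valid at
`w = 0`, where the variable is almost surely constant. -/
theorem measure_sqrt_lt_abs_sub_integral_le {Ω : Type*} [MeasurableSpace Ω] (Q : Measure Ω)
    [IsProbabilityMeasure Q] {X : Ω → ℝ} (hX : MemLp X 2 Q) {k w : ℝ} (hk : 0 < k)
    (hw : Var[X; Q] ≤ w) : Q {ω | √(k * w) < |X ω - Q[X]|} ≤ ENNReal.ofReal (1 / k) := by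
  have hw0 : 0 ≤ w := (variance_nonneg _ _).trans hw
  rcases hw0.eq_or_lt with h0 | hpos
  · have hv : Var[X; Q] = 0 := le_antisymm (h0 ▸ hw) (variance_nonneg _ _)
    have := ae_eq_integral_of_variance_eq_zero hX hv
    have hz : Q {ω | √(k * w) < |X ω - Q[X]|} = 0 := by
      rw [← h0]
      refine measure_mono_null (fun ω hω => ?_) (ae_iff.1 this)
      intro he
      simp [he] at hω
    rw [hz]
    exact zero_le
  · have hc : 0 < √(k * w) := Real.sqrt_pos.2 (by positivity)
    refine (measure_mono fun ω hω => ?_).trans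
      ((meas_ge_le_variance_div_sq hX hc).trans (ENNReal.ofReal_le_ofReal ?_))
    · exact (show √(k * w) < |X ω - Q[X]| from hω).le
    · rw [Real.sq_sqrt (by positivity), div_le_div_iff₀ (by positivity) hk]
      nlinarith

variable {n : ℕ} {Z : Type*} [MeasurableSpace Z] (P : Measure Z) [IsProbabilityMeasure P]

theorem integral_pi_sum {g : Z → ℝ} (hg : MemLp g 2 P) :
    ∫ s, ∑ i, g (s i) ∂(Measure.pi fun _ : Fin n => P) = n * ∫ z, g z ∂P := by
  have hi := hg.integrable one_le_two
  have hi' : ∀ i ∈ Finset.univ,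
      Integrable (fun s : Fin n → Z => g (s i)) (Measure.pi fun _ : Fin n => P) := fun i _ =>
    (measurePreserving_eval (fun _ : Fin n => P) i).integrable_comp_of_integrable hi
  rw [integral_finsetSum _ hi']
  have : ∀ i : Fin n, ∫ s : Fin n → Z, g (s i) ∂(Measure.pi fun _ : Fin n => P) = ∫ z, g z ∂P :=
    fun i => integral_comp_eval (μ := fun _ : Fin n => P) hi.aestronglyMeasurable
  simp [this]

theorem variance_pi_sum {g : Z → ℝ} (hg : MemLp g 2 P) :
    Var[fun s => ∑ i, g (s i); Measure.pi fun _ : Fin n => P] = n * Var[g; P] := by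
  have := variance_sum_pi (μ := fun _ : Fin n => P) (X := fun _ => g) fun _ => hg
  rw [Finset.sum_fn] at this
  rw [this]
  simp

theorem memLp_pi_sum {g : Z → ℝ} (hg : MemLp g 2 P) :
    MemLp (fun s => ∑ i, g (s i)) 2 (Measure.pi fun _ : Fin n => P) :=
  memLp_finsetSum _ fun i _ => hg.comp_measurePreserving (measurePreserving_eval _ i)

/-- With probability at least `1 / 3` a ghost sample satisfies the second moment form of the
empirical Bernstein inequality. -/
theorem one_third_le_measure_ghost (hn : 35 ≤ n) {f : Z → ℝ} (hf : Measurable f)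
    (hf01 : ∀ z, f z ∈ Set.Icc (0 : ℝ) 1) :
    1 / 3 ≤ (Measure.pi fun _ : Fin n => P) {s | ∫ z, f z ∂P - mean (fun i => f (s i)) ≤
      (3.7 + 1.46 * √(sumSqDev fun i => f (s i))) / n} := by
  set Q := Measure.pi fun _ : Fin n => P with hQ
  set m := ∫ z, f z ∂P with hm
  set v := Var[f; P] with hv
  have hn' : (0 : ℝ) < n := by positivity
  have hv0 : 0 ≤ v := variance_nonneg _ _
  have hfL : MemLp f 2 P := MemLp.of_bound hf.aestronglyMeasurable 1 (ae_of_all _ fun z => by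
    rw [Real.norm_eq_abs, abs_of_nonneg (hf01 z).1]; exact (hf01 z).2)
  have hm01 : m ∈ Set.Icc (0 : ℝ) 1 := by
    refine ⟨integral_nonneg fun z => (hf01 z).1, ?_⟩
    have := integral_mono (hfL.integrable one_le_two) (integrable_const (1 : ℝ))
      fun z => (hf01 z).2
    simpa using this
  set g : Z → ℝ := fun z => (f z - m) ^ 2 with hg
  have hg01 : ∀ z, 0 ≤ g z ∧ g z ≤ 1 := fun z => ⟨sq_nonneg _,
    (sq_le_one_iff_abs_le_one _).2 (abs_le.2
      ⟨by linarith [(hf01 z).1, hm01.2], by linarith [(hf01 z).2, hm01.1]⟩)⟩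
  have hgm : Measurable g := by fun_prop
  have hgL : MemLp g 2 P := MemLp.of_bound hgm.aestronglyMeasurable 1 (ae_of_all _ fun z => by
    rw [Real.norm_eq_abs, abs_of_nonneg (hg01 z).1]; exact (hg01 z).2)
  have hgv : ∫ z, g z ∂P = v := (variance_eq_integral hf.aemeasurable).symm
  -- As `g` takes values in `[0, 1]`, `Var g ≤ E g² ≤ E g = v`.
  have hgvar : Var[g; P] ≤ v := by
    refine (variance_le_expectation_sq hgm.aestronglyMeasurable).trans ?_
    rw [← hgv]
    refine integral_mono hgL.integrable_sq (hgL.integrable one_le_two) fun z => ?_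
    have := hg01 z
    simp only [Pi.pow_apply]
    nlinarith
  have c1 := measure_sqrt_lt_abs_sub_integral_le Q (memLp_pi_sum P hfL) (k := 2) (w := n * v)
    (by norm_num) (variance_pi_sum P hfL).le
  have c2 := measure_sqrt_lt_abs_sub_integral_le Q (memLp_pi_sum P hgL) (k := 6) (w := n * v)
    (by norm_num) ((variance_pi_sum P hgL).le.trans (mul_le_mul_of_nonneg_left hgvar hn'.le))
  rw [integral_pi_sum P hfL] at c1
  rw [integral_pi_sum P hgL, hgv] at c2
  set B1 := {s : Fin n → Z | √(2 * (n * v)) < |∑ i, f (s i) - n * m|}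
  set B2 := {s : Fin n → Z | √(6 * (n * v)) < |∑ i, g (s i) - n * v|}
  have hsub : (B1 ∪ B2)ᶜ ⊆ {s | m - mean (fun i => f (s i)) ≤
      (3.7 + 1.46 * √(sumSqDev fun i => f (s i))) / n} := by
    intro s hs
    simp only [B1, B2, Set.compl_union, Set.mem_inter_iff, Set.mem_compl_iff, Set.mem_ofPred_eq,
      not_lt] at hs
    refine sub_mean_le_of_ghost hn hv0 ?_ ?_
    · have h1 := pow_le_pow_left₀ (abs_nonneg _) hs.1 2
      rw [sq_abs, Real.sq_sqrt (by positivity)] at h1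
      have e : mean (fun i => f (s i)) - m = (∑ i, f (s i) - n * m) / n := by
        rw [mean]; field_simp
      rw [e, div_pow, div_le_div_iff₀ (by positivity) hn']
      nlinarith
    · have := (abs_le.1 hs.2).1
      linarith
  have hBm : MeasurableSet (B1 ∪ B2) := by
    refine MeasurableSet.union ?_ ?_ <;> refine measurableSet_lt measurable_const ?_ <;> fun_prop
  -- The Chebyshev failures for `k = 2` and `k = 6` add up to `1/2 + 1/6`.
  have hB : Q (B1 ∪ B2) ≤ ENNReal.ofReal (2 / 3) := by
    refine (measure_union_le _ _).trans ((add_le_add c1 c2).trans ?_)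
    rw [← ENNReal.ofReal_add (by norm_num) (by norm_num)]
    exact ENNReal.ofReal_le_ofReal (by norm_num)
  refine le_trans ?_ (measure_mono hsub)
  rw [prob_compl_eq_one_sub hBm]
  have e : (1 / 3 : ℝ≥0∞) = 1 - ENNReal.ofReal (2 / 3) := by
    rw [← ENNReal.ofReal_one, ← ENNReal.ofReal_sub _ (by norm_num)]
    have : (1 : ℝ) - 2 / 3 = 1 / 3 := by norm_num
    rw [this, ENNReal.ofReal_div_of_pos (by norm_num)]
    simp
  rw [e]
  exact tsub_le_tsub_left hB _

/-- Symmetrization by a ghost sample: the deviation probability is controlled by that of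
double samples. -/
theorem measure_exists_deviation_le (hn : 35 ≤ n) {t : ℝ} {T : Type*} {F : T → Z → ℝ}
    (hF : ∀ τ, Measurable (F τ)) (hF01 : ∀ τ z, F τ z ∈ Set.Icc (0 : ℝ) 1) :
    (Measure.pi fun _ : Fin n => P) {s | ∃ τ, mean (fun i => F τ (s i)) +
        √(18 * (sumSqDev (fun i => F τ (s i)) / (n - 1)) * t / n) + 15 * t / (n - 1) <
          ∫ z, F τ z ∂P} ≤
      3 * (Measure.pi fun _ : Fin n => P.prod P)
        {z | ∃ τ, (fun i => (F τ (z i).1, F τ (z i).2)) ∈ badDouble n t} := by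
  set Q := Measure.pi fun _ : Fin n => P with hQ
  set B := {z : Fin n → Z × Z | ∃ τ, (fun i => (F τ (z i).1, F τ (z i).2)) ∈ badDouble n t}
  set R := Measure.pi fun _ : Fin n => P.prod P
  set e := MeasurableEquiv.arrowProdEquivProdArrow Z Z (Fin n) with he
  have hmp : MeasurePreserving e R (Q.prod Q) :=
    measurePreserving_arrowProdEquivProdArrow Z Z (Fin n) (fun _ => P) fun _ => P
  -- A measurable hull of the double sample event permits Fubini and then Markov at level `1/3` on
  -- its sections.
  set C := e.symm ⁻¹' toMeasurable R B with hC
  have hCm : MeasurableSet C := e.symm.measurable (measurableSet_toMeasurable _ _)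
  have hCB : (Q.prod Q) C = R B := by
    rw [← measure_toMeasurable B, hC]
    exact (hmp.symm).measure_preimage (measurableSet_toMeasurable _ _).nullMeasurableSet
  rw [← hCB, Measure.prod_apply hCm]
  have hmark := mul_meas_ge_le_lintegral (μ := Q) (measurable_measure_prodMk_left (ν := Q) hCm)
    (1 / 3)
  have hsub : {s | ∃ τ, mean (fun i => F τ (s i)) +
        √(18 * (sumSqDev (fun i => F τ (s i)) / (n - 1)) * t / n) + 15 * t / (n - 1) <
          ∫ z, F τ z ∂P} ⊆ {s | 1 / 3 ≤ Q (Prod.mk s ⁻¹' C)} := by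
    rintro s ⟨τ, hτ⟩
    refine (one_third_le_measure_ghost P hn (hF τ) (hF01 τ)).trans (measure_mono fun s' hs' => ?_)
    refine subset_toMeasurable _ _ ?_
    refine ⟨τ, ?_⟩
    have h1 : ∀ i, e.symm (s, s') i = (s i, s' i) := fun i => rfl
    simp only [h1, badDouble, Set.mem_ofPred_eq] at hs' ⊢
    linarith
  calc Q _ ≤ Q {s | 1 / 3 ≤ Q (Prod.mk s ⁻¹' C)} := measure_mono hsub
    _ = 3 * (1 / 3 * Q {s | 1 / 3 ≤ Q (Prod.mk s ⁻¹' C)}) := by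
        rw [← mul_assoc, ENNReal.mul_div_cancel (by simp) (by simp), one_mul]
    _ ≤ _ := mul_le_mul_right hmark 3

end Ghost

/-! ### Clipped losses, risk and rescaling. -/

variable {X Y : Type*} [MeasurableSpace X] [MeasurableSpace Y]

theorem prob_nonneg (h : Kernel X Y) (y : Y) (x : X) : 0 ≤ prob h y x := measureReal_nonneg

theorem measurable_prob [Countable Y] [MeasurableSingletonClass Y] (h : Kernel X Y) :
    Measurable fun z : X × Y => prob h z.2 z.1 :=
  measurable_from_prod_countable_left fun y =>
    (h.measurable_coe (measurableSet_singleton y)).ennreal_toReal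

theorem measurable_clippedLoss [Countable Y] [MeasurableSingletonClass Y] (h₀ h : Kernel X Y)
    {δ : X × Y → ℝ} (hδ : Measurable δ) (M : ℝ) : Measurable (clippedLoss h₀ δ M h) :=
  hδ.mul (measurable_const.min ((measurable_prob h).div (measurable_prob h₀)))

theorem auxFun_eq_one_add_clippedLoss (h₀ h : Kernel X Y) (δ : X × Y → ℝ) (M : ℝ) (z : X × Y) :
    auxFun h₀ δ M h z = 1 + clippedLoss h₀ δ M h z / M := by
  rw [auxFun, clippedLoss]; ring

theorem clippedLoss_eq_mul {M : ℝ} (hM : 0 < M) (h₀ h : Kernel X Y) (δ : X × Y → ℝ) (z : X × Y) :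
    clippedLoss h₀ δ M h z = M * (auxFun h₀ δ M h z - 1) := by
  rw [auxFun_eq_one_add_clippedLoss]; field_simp; ring

theorem abs_clippedLoss_le {M : ℝ} (hM : 0 < M) (h₀ h : Kernel X Y) {δ : X × Y → ℝ}
    (hδ : ∀ z, δ z ∈ Set.Icc (-1 : ℝ) 0) (z : X × Y) : |clippedLoss h₀ δ M h z| ≤ M := by
  obtain ⟨h1, h2⟩ := auxFun_mem_Icc (h₀ := h₀) (h := h) hM hδ z
  rw [clippedLoss_eq_mul hM, abs_le]
  constructor <;> nlinarith

theorem measurable_auxFun [Countable Y] [MeasurableSingletonClass Y] (h₀ h : Kernel X Y)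
    {δ : X × Y → ℝ} (hδ : Measurable δ) (M : ℝ) : Measurable (auxFun h₀ δ M h) := by
  have : auxFun h₀ δ M h = fun z => 1 + clippedLoss h₀ δ M h z / M :=
    funext fun z => auxFun_eq_one_add_clippedLoss h₀ h δ M z
  rw [this]
  exact ((measurable_clippedLoss h₀ h hδ M).div_const M).const_add 1

theorem hasSum_integral_singleton [Countable Y] [MeasurableSingletonClass Y] {ν : Measure Y}
    {f : Y → ℝ} (hf : Integrable f ν) : HasSum (fun y => ν.real {y} * f y) (∫ y, f y ∂ν) := by
  have h := hasSum_integral_iUnion (μ := ν) (f := f) (s := fun y : Y => {y})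
    (fun y => measurableSet_singleton y)
    (fun y y' hne => Set.disjoint_singleton.2 hne) hf.integrableOn
  rw [Set.iUnion_of_singleton, setIntegral_univ] at h
  simp only [integral_singleton, smul_eq_mul] at h
  exact h

/-- Clipping a nonpositive importance-weighted loss can only increase its expectation. -/
theorem integral_le_integral_clippedLoss [Countable Y] [MeasurableSingletonClass Y]
    (h₀ h : Kernel X Y) [IsMarkovKernel h₀] [IsMarkovKernel h] {δ : X × Y → ℝ}
    (hδm : Measurable δ) (hδ : ∀ z, δ z ∈ Set.Icc (-1 : ℝ) 0) {M : ℝ} (hM : 0 < M) (x : X) :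
    ∫ y, δ (x, y) ∂(h x) ≤ ∫ y, clippedLoss h₀ δ M h (x, y) ∂(h₀ x) := by
  have i1 : Integrable (fun y => δ (x, y)) (h x) :=
    Integrable.of_bound (hδm.comp measurable_prodMk_left).aestronglyMeasurable 1
      (ae_of_all _ fun y => abs_le.2 ⟨(hδ _).1, (hδ _).2.trans zero_le_one⟩)
  have i2 : Integrable (fun y => clippedLoss h₀ δ M h (x, y)) (h₀ x) :=
    Integrable.of_bound
      ((measurable_clippedLoss h₀ h hδm M).comp measurable_prodMk_left).aestronglyMeasurable M
      (ae_of_all _ fun y => abs_clippedLoss_le hM h₀ h hδ _)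
  refine hasSum_le (fun y => ?_) (hasSum_integral_singleton i1) (hasSum_integral_singleton i2)
  have e1 : (h x).real {y} = prob h y x := rfl
  have e2 : (h₀ x).real {y} = prob h₀ y x := rfl
  rw [e1, e2, clippedLoss]
  have p1 := prob_nonneg h y x
  have p2 := prob_nonneg h₀ y x
  -- Where `h₀` gives no mass the left side is zero. Multiplying by the nonpositive loss reverses
  -- the inequality.
  have key : prob h₀ y x * min M (prob h y x / prob h₀ y x) ≤ prob h y x := by
    refine (mul_le_mul_of_nonneg_left (min_le_right _ _) p2).trans ?_
    rcases p2.eq_or_lt with h0 | hp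
    · rw [← h0]; simpa using p1
    · rw [mul_div_cancel₀ _ hp.ne']
  have := mul_le_mul_of_nonpos_left key (hδ (x, y)).2
  simp only
  linarith

theorem integrable_auxFun [Countable Y] [MeasurableSingletonClass Y] (h₀ h : Kernel X Y)
    {δ : X × Y → ℝ} (hδm : Measurable δ) (hδ : ∀ z, δ z ∈ Set.Icc (-1 : ℝ) 0) {M : ℝ} (hM : 0 < M)
    (P : Measure (X × Y)) [IsFiniteMeasure P] : Integrable (auxFun h₀ δ M h) P :=
  Integrable.of_bound (measurable_auxFun h₀ h hδm M).aestronglyMeasurable 1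
    (ae_of_all _ fun z => by
      have := auxFun_mem_Icc (h₀ := h₀) (h := h) hM hδ z
      rw [Real.norm_eq_abs, abs_of_nonneg this.1]; exact this.2)

/-- The clipping inequality is integrated over inputs. Only the upper deviation of `E f_h` then
matters, and the clipping bias has the favourable sign. -/
theorem risk_le_integral_auxFun [Countable Y] [MeasurableSingletonClass Y]
    (μ : Measure X) [IsProbabilityMeasure μ] (h₀ h : Kernel X Y) [IsMarkovKernel h₀]
    [IsMarkovKernel h] {δ : X × Y → ℝ} (hδm : Measurable δ)
    (hδ : ∀ z, δ z ∈ Set.Icc (-1 : ℝ) 0) {M : ℝ} (hM : 0 < M) :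
    risk μ δ h ≤ M * (∫ z, auxFun h₀ δ M h z ∂(μ.compProd h₀) - 1) := by
  have ic : Integrable (clippedLoss h₀ δ M h) (μ.compProd h₀) :=
    Integrable.of_bound (measurable_clippedLoss h₀ h hδm M).aestronglyMeasurable M
      (ae_of_all _ fun z => abs_clippedLoss_le hM h₀ h hδ z)
  have e : M * (∫ z, auxFun h₀ δ M h z ∂(μ.compProd h₀) - 1) =
      ∫ z, clippedLoss h₀ δ M h z ∂(μ.compProd h₀) := by
    have : ∀ z, clippedLoss h₀ δ M h z = M * (auxFun h₀ δ M h z - 1) :=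
      clippedLoss_eq_mul hM h₀ h δ
    simp_rw [this]
    rw [integral_const_mul, integral_sub (integrable_auxFun h₀ h hδm hδ hM _)
      (integrable_const _)]
    simp
  rw [e, Measure.integral_compProd ic, risk]
  refine integral_mono ?_ ic.integral_compProd fun x =>
    integral_le_integral_clippedLoss h₀ h hδm hδ hM x
  refine Integrable.of_bound
    (hδm.stronglyMeasurable.integral_kernel_prod_right' (κ := h)).aestronglyMeasurable 1
    (ae_of_all _ fun x => ?_)
  refine (norm_integral_le_of_norm_le_const (ae_of_all _ fun y =>
    abs_le.2 ⟨(hδ (x, y)).1, (hδ (x, y)).2.trans zero_le_one⟩)).trans ?_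
  simp

theorem ipsEstimate_eq {n : ℕ} (hn : 0 < n) {M : ℝ} (hM : 0 < M) (h₀ h : Kernel X Y)
    (δ : X × Y → ℝ) (s : Fin n → X × Y) :
    ipsEstimate h₀ δ M s h = M * (mean (fun i => auxFun h₀ δ M h (s i)) - 1) := by
  have hn' : (n : ℝ) ≠ 0 := by positivity
  simp only [ipsEstimate, mean, clippedLoss_eq_mul hM, ← Finset.mul_sum, Finset.sum_sub_distrib]
  simp only [Finset.sum_const, Finset.card_univ, Fintype.card_fin, nsmul_eq_mul, mul_one]
  field_simp

theorem sampleVar_eq {n : ℕ} (hn : 0 < n) {M : ℝ} (hM : 0 < M) (h₀ h : Kernel X Y)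
    (δ : X × Y → ℝ) (s : Fin n → X × Y) :
    sampleVar h₀ δ M s h =
      M ^ 2 * (sumSqDev (fun i => auxFun h₀ δ M h (s i)) / (n - 1)) := by
  rw [sampleVar, ipsEstimate_eq hn hM, sumSqDev, ← mul_div_assoc, Finset.mul_sum]
  congr 1
  refine Finset.sum_congr rfl fun i _ => ?_
  rw [clippedLoss_eq_mul hM]
  ring

/-- The deviation bound for the auxiliary functions, rescaled to the clipped losses. -/
theorem risk_le_of_integral_auxFun_le [Countable Y] [MeasurableSingletonClass Y]
    (μ : Measure X) [IsProbabilityMeasure μ] (h₀ h : Kernel X Y) [IsMarkovKernel h₀]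
    [IsMarkovKernel h] {δ : X × Y → ℝ} (hδm : Measurable δ)
    (hδ : ∀ z, δ z ∈ Set.Icc (-1 : ℝ) 0) {M : ℝ} (hM : 0 < M) {n : ℕ} (hn : 0 < n)
    (s : Fin n → X × Y) (t : ℝ)
    (hs : ∫ z, auxFun h₀ δ M h z ∂(μ.compProd h₀) ≤ mean (fun i => auxFun h₀ δ M h (s i)) +
      √(18 * (sumSqDev (fun i => auxFun h₀ δ M h (s i)) / (n - 1)) * t / n)
      + 15 * t / (n - 1)) :
    risk μ δ h ≤ ipsEstimate h₀ δ M s h + √(18 * sampleVar h₀ δ M s h * t / n)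
      + M * (15 * t / (n - 1)) := by
  refine (risk_le_integral_auxFun μ h₀ h hδm hδ hM).trans ?_
  rw [ipsEstimate_eq hn hM, sampleVar_eq hn hM]
  have e : 18 * (M ^ 2 * (sumSqDev (fun i => auxFun h₀ δ M h (s i)) / ((n : ℝ) - 1))) * t / n =
      M ^ 2 * (18 * (sumSqDev (fun i => auxFun h₀ δ M h (s i)) / (n - 1)) * t / n) := by ring
  rw [e, Real.sqrt_mul (sq_nonneg M), Real.sqrt_sq hM.le]
  have := mul_le_mul_of_nonneg_left hs hM.le
  linarith

/-! ### Covers of double samples, a numerical constant and limits of policies. -/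

/-- Splitting a sample of size `2 n` into two halves. -/
def halvesEquiv (n : ℕ) : Fin n ⊕ Fin n ≃ Fin (2 * n) :=
  finSumFinEquiv.trans (finCongr (two_mul n).symm)

/-- A finite uniform covering number provides finite covers on double samples. -/
theorem exists_finset_cover_pairs {Z : Type*} {n N : ℕ} {F : Set (Z → ℝ)}
    (hF : ∀ f ∈ F, ∀ z, f z ∈ Set.Icc (0 : ℝ) 1)
    (hN : unifCoveringNumber (1 / (n : ℝ≥0)) F (2 * n) ≤ N) (z : Fin n → Z × Z) :
    ∃ C : Finset (Fin n → ℝ × ℝ), C.card ≤ N ∧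
      (∀ c ∈ C, ∀ i, (c i).1 ∈ Set.Icc (0 : ℝ) 1 ∧ (c i).2 ∈ Set.Icc (0 : ℝ) 1) ∧
      ∀ f ∈ F, ∃ c ∈ C, ∀ i, |f (z i).1 - (c i).1| ≤ 1 / n ∧ |f (z i).2 - (c i).2| ≤ 1 / n := by
  classical
  let e := halvesEquiv n
  let z' : Fin (2 * n) → Z := fun j =>
    Sum.elim (fun i => (z i).1) (fun i => (z i).2) (e.symm j)
  set A := (fun (f : Z → ℝ) (i : Fin (2 * n)) => f (z' i)) '' F with hA
  have hle : Metric.coveringNumber (1 / (n : ℝ≥0)) A ≤ N :=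
    (le_iSup (fun z : Fin (2 * n) → Z => Metric.coveringNumber (1 / (n : ℝ≥0))
      ((fun (f : Z → ℝ) (i : Fin (2 * n)) => f (z i)) '' F)) z').trans hN
  obtain ⟨C, hCA, hCf, hC, hcard⟩ := Metric.exists_set_encard_eq_coveringNumber
    (ne_top_of_le_ne_top (ENat.natCast_ne_top N) hle)
  let φ : (Fin (2 * n) → ℝ) → Fin n → ℝ × ℝ := fun c i => (c (e (.inl i)), c (e (.inr i)))
  refine ⟨hCf.toFinset.image φ, ?_, ?_, ?_⟩
  · refine Finset.card_image_le.trans ?_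
    rw [← hcard, hCf.encard_eq_coe_toFinset_card] at hle
    exact_mod_cast hle
  -- Centres of the cover belong to the covered set, hence are values of the class and stay in `[0,
  -- 1]`.
  · intro c hc i
    obtain ⟨c', hc', rfl⟩ := Finset.mem_image.1 hc
    obtain ⟨f, hf, rfl⟩ := hCA (hCf.mem_toFinset.1 hc')
    exact ⟨hF f hf _, hF f hf _⟩
  · intro f hf
    obtain ⟨c, hcC, hc⟩ := hC (show (fun i => f (z' i)) ∈ A from ⟨f, hf, rfl⟩)
    refine ⟨φ c, Finset.mem_image_of_mem _ (hCf.mem_toFinset.2 hcC), fun i => ?_⟩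
    have hd : dist (fun i => f (z' i)) c ≤ 1 / n := by
      have hc' : edist (fun i => f (z' i)) c ≤ ((1 / (n : ℝ≥0) : ℝ≥0) : ℝ≥0∞) := hc
      rw [edist_nndist, ENNReal.coe_le_coe] at hc'
      have := NNReal.coe_le_coe.2 hc'
      simpa using this
    have hj : ∀ j, |f (z' j) - c j| ≤ 1 / n := fun j => by
      rw [← Real.dist_eq]
      exact (dist_le_pi_dist (fun i => f (z' i)) c j).trans hd
    have h1 := hj (e (.inl i))
    have h2 := hj (e (.inr i))
    simp only [z', Equiv.symm_apply_apply, Sum.elim_inl, Sum.elim_inr] at h1 h2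
    exact ⟨h1, h2⟩

theorem one_le_toNat_unifCoveringNumber {Z : Type*} {ε : ℝ≥0} {F : Set (Z → ℝ)} {m : ℕ}
    [Nonempty Z] (hF : F.Nonempty) (h : unifCoveringNumber ε F m ≠ ⊤) :
    1 ≤ (unifCoveringNumber ε F m).toNat := by
  have z : Fin m → Z := fun _ => Classical.arbitrary Z
  have h0 : 0 < unifCoveringNumber ε F m :=
    (Metric.coveringNumber_pos_iff.2 (hF.image _)).trans_le (le_iSup (fun z : Fin m → Z =>
      Metric.coveringNumber ε ((fun (f : Z → ℝ) (i : Fin m) => f (z i)) '' F)) z)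
  rw [Nat.one_le_iff_ne_zero, Ne, ENat.toNat_eq_zero]
  exact fun hh => hh.elim h0.ne' h

/-- The factor 10 inside the logarithm forces `t ≥ 9/4`, that is `√t ≥ 3/2`, which the constants in
`not_mem_badDouble` need. -/
theorem nine_div_four_le_log_ten : (9 / 4 : ℝ) ≤ Real.log 10 := by
  have h : Real.exp 9 ≤ 10 ^ 4 := by
    have e : Real.exp 9 = Real.exp 1 ^ 9 := by rw [← Real.exp_nat_mul]; norm_num
    rw [e]
    have := pow_le_pow_left₀ (Real.exp_pos 1).le Real.exp_one_lt_d9.le 9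
    refine this.trans (by norm_num)
  have h2 := (Real.le_log_iff_exp_le (by norm_num)).2 h
  rw [Real.log_pow] at h2
  push_cast at h2
  linarith

/-- The deviation bounds for the auxiliary functions pass to pointwise limits of policies. -/
theorem integral_auxFun_le_of_tendsto [Countable Y] [MeasurableSingletonClass Y]
    (P : Measure (X × Y)) [IsProbabilityMeasure P] (h₀ h : Kernel X Y) {g : ℕ → Kernel X Y}
    {δ : X × Y → ℝ} (hδm : Measurable δ) (hδ : ∀ z, δ z ∈ Set.Icc (-1 : ℝ) 0) {M : ℝ}
    (hM : 0 < M) (hg : ∀ x y, Tendsto (fun k => prob (g k) y x) atTop (𝓝 (prob h y x)))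
    {n : ℕ} (s : Fin n → X × Y) (t : ℝ)
    (hs : ∀ k, ∫ z, auxFun h₀ δ M (g k) z ∂P ≤ mean (fun i => auxFun h₀ δ M (g k) (s i)) +
      √(18 * (sumSqDev (fun i => auxFun h₀ δ M (g k) (s i)) / (n - 1)) * t / n)
      + 15 * t / (n - 1)) :
    ∫ z, auxFun h₀ δ M h z ∂P ≤ mean (fun i => auxFun h₀ δ M h (s i)) +
      √(18 * (sumSqDev (fun i => auxFun h₀ δ M h (s i)) / (n - 1)) * t / n)
      + 15 * t / (n - 1) := by
  have hlim : ∀ z, Tendsto (fun k => auxFun h₀ δ M (g k) z) atTop (𝓝 (auxFun h₀ δ M h z)) :=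
    fun z => (((tendsto_const_nhds.min ((hg z.1 z.2).div_const _)).const_mul _).const_add 1)
  have hI : Tendsto (fun k => ∫ z, auxFun h₀ δ M (g k) z ∂P) atTop
      (𝓝 (∫ z, auxFun h₀ δ M h z ∂P)) := by
    refine tendsto_integral_of_dominated_convergence (fun _ => 1)
      (fun k => (measurable_auxFun h₀ (g k) hδm M).aestronglyMeasurable) (integrable_const _)
      (fun k => ae_of_all _ fun z => ?_) (ae_of_all _ hlim)
    have := auxFun_mem_Icc (h₀ := h₀) (h := g k) hM hδ z
    rw [Real.norm_eq_abs, abs_of_nonneg this.1]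
    exact this.2
  have hvec : Tendsto (fun k (i : Fin n) => auxFun h₀ δ M (g k) (s i)) atTop
      (𝓝 fun i => auxFun h₀ δ M h (s i)) := tendsto_pi_nhds.2 fun i => hlim (s i)
  have hcont : Continuous fun a : Fin n → ℝ =>
      mean a + √(18 * (sumSqDev a / (n - 1)) * t / n) + 15 * t / (n - 1) := by
    unfold sumSqDev mean
    fun_prop
  exact le_of_tendsto_of_tendsto' hI ((hcont.tendsto _).comp hvec) hs

end CRM

/-! ### Assembly of the bound. -/

theorem theorem1 {X Y : Type*} [MeasurableSpace X] [MeasurableSpace Y] [Countable Y]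
    [MeasurableSingletonClass Y]
    (μ : Measure X) [IsProbabilityMeasure μ]
    (h₀ : Kernel X Y) [IsMarkovKernel h₀]
    (δ : X × Y → ℝ) (hδ_meas : Measurable δ) (hδ : ∀ z, δ z ∈ Set.Icc (-1 : ℝ) 0)
    (M : ℝ) (hM : 0 < M)
    (H : Set (Kernel X Y)) (hH : ∀ h ∈ H, IsMarkovKernel h) (hH_perm : CRM.IsPermissible H)
    (n : ℕ) (hn : 16 ≤ n) (γ : ℝ) (hγ₀ : 0 < γ) (hγ₁ : γ < 1) :
    ∃ E : Set (Fin n → X × Y), MeasurableSet E ∧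
      1 - γ ≤ (Measure.pi fun _ : Fin n => μ.compProd h₀).real E ∧
      ∀ s ∈ E, ∀ h ∈ H,
        CRM.risk μ δ h ≤ CRM.ipsEstimate h₀ δ M s h
          + Real.sqrt (18 * CRM.sampleVar h₀ δ M s h * CRM.capacityLog h₀ δ M H n γ / n)
          + M * (15 * CRM.capacityLog h₀ δ M H n γ / ((n : ℝ) - 1)) := by
  open CRM in
  set P := μ.compProd h₀ with hP
  set t := capacityLog h₀ δ M H n γ with ht
  have hn0 : 0 < n := by omega
  have hn' : (16 : ℝ) ≤ n := by exact_mod_cast hn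
  have h01 : ∀ (h : Kernel X Y) z, auxFun h₀ δ M h z ∈ Set.Icc (0 : ℝ) 1 := fun h z =>
    auxFun_mem_Icc hM hδ z
  suffices key : ∃ E : Set (Fin n → X × Y), MeasurableSet E ∧
      1 - γ ≤ (Measure.pi fun _ : Fin n => P).real E ∧
      ∀ s ∈ E, ∀ h ∈ H, ∫ z, auxFun h₀ δ M h z ∂P ≤ mean (fun i => auxFun h₀ δ M h (s i)) +
        √(18 * (sumSqDev (fun i => auxFun h₀ δ M h (s i)) / (n - 1)) * t / n)
        + 15 * t / (n - 1) by
    obtain ⟨E, hE, hE1, hE2⟩ := key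
    refine ⟨E, hE, hE1, fun s hs h hh => ?_⟩
    have := hH h hh
    exact risk_le_of_integral_auxFun_le μ h₀ h hδ_meas hδ hM hn0 s t (hE2 s hs h hh)
  -- An empty class has covering number 0, which the logarithm below cannot accommodate; the claim
  -- is then vacuous.
  rcases H.eq_empty_or_nonempty with rfl | hHne
  · exact ⟨Set.univ, .univ, by simp [hγ₀.le], fun _ _ _ hh => hh.elim⟩
  -- In this case the last term alone is at least 1, an upper bound for every `E f_h`.
  by_cases htriv : (n : ℝ) - 1 ≤ 15 * t
  · refine ⟨Set.univ, .univ, by simp [hγ₀.le], fun s _ h _ => ?_⟩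
    have h1 : ∫ z, auxFun h₀ δ M h z ∂P ≤ 1 := by
      have := integral_mono (integrable_auxFun h₀ h hδ_meas hδ hM P) (integrable_const (1 : ℝ))
        fun z => (h01 h z).2
      simpa using this
    have h2 : 1 ≤ 15 * t / (n - 1) := (one_le_div (by linarith)).2 htriv
    have h3 := (mean_mem_Icc (a := fun i => auxFun h₀ δ M h (s i)) fun i => h01 h (s i)).1
    have h4 := Real.sqrt_nonneg
      (18 * (sumSqDev (fun i => auxFun h₀ δ M h (s i)) / (n - 1)) * t / n)
    linarith
  push Not at htriv
  have : Nonempty (X × Y) := by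
    by_contra hne
    rw [not_nonempty_iff] at hne
    have h1 : P Set.univ = 1 := measure_univ
    simp [Set.univ_eq_empty_iff.2 hne] at h1
  have hfin : unifCoveringNumber (1 / (n : ℝ≥0)) (auxClass h₀ δ M H) (2 * n) ≠ ⊤ :=
    unifCoveringNumber_auxClass_ne_top hM hδ (by positivity) _
  set N := (unifCoveringNumber (1 / (n : ℝ≥0)) (auxClass h₀ δ M H) (2 * n)).toNat with hN
  have hN1 : 1 ≤ N := one_le_toNat_unifCoveringNumber (hHne.image _) hfin
  have hN1' : (1 : ℝ) ≤ N := by exact_mod_cast hN1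
  have ht' : t = Real.log (10 * N / γ) := rfl
  have hexp : Real.exp (-t) = γ / (10 * N) := by
    rw [ht', Real.exp_neg, Real.exp_log (by positivity), inv_div]
  have ht1 : 9 / 4 ≤ t := by
    refine nine_div_four_le_log_ten.trans (Real.log_le_log (by norm_num) ?_)
    rw [le_div_iff₀ hγ₀]
    nlinarith
  -- From `n - 1 > 15 t ≥ 15 · 9/4 = 33.75`.
  have hn35 : 35 ≤ n := by
    have : ((34 : ℕ) : ℝ) < n := by push_cast; linarith
    exact_mod_cast this
  obtain ⟨T, _, _, κ, hκ, hlim⟩ := hH_perm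
  choose p hpH hp using hκ
  let F : T → X × Y → ℝ := fun τ => auxFun h₀ δ M (p τ)
  have hFm : Measurable (Function.uncurry F) := by
    -- The chosen policies `p τ` carry no joint measurability themselves; replacing them by sections
    -- of `κ` supplies it.
    have e : Function.uncurry F = fun q : T × X × Y =>
        1 + δ q.2 / M * min M (prob κ q.2.2 (q.1, q.2.1) / prob h₀ q.2.2 q.2.1) := by
      funext ⟨τ, z⟩
      simp only [Function.uncurry, F, auxFun, prob, hp]
    rw [e]
    have m1 : Measurable fun q : T × X × Y => prob κ q.2.2 (q.1, q.2.1) :=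
      (measurable_prob κ).comp (by fun_prop : Measurable fun q : T × X × Y =>
        ((q.1, q.2.1), q.2.2))
    have m2 : Measurable fun q : T × X × Y => prob h₀ q.2.2 q.2.1 :=
      (measurable_prob h₀).comp measurable_snd
    exact (((hδ_meas.comp measurable_snd).div_const M).mul
      (measurable_const.min (m1.div m2))).const_add 1
  have hcov : ∀ z : Fin n → (X × Y) × (X × Y), ∃ C : Finset (Fin n → ℝ × ℝ), C.card ≤ N ∧
      (∀ c ∈ C, ∀ i, (c i).1 ∈ Set.Icc (0 : ℝ) 1 ∧ (c i).2 ∈ Set.Icc (0 : ℝ) 1) ∧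
      ∀ τ, ∃ c ∈ C, ∀ i, |F τ (z i).1 - (c i).1| ≤ 1 / n ∧
        |F τ (z i).2 - (c i).2| ≤ 1 / n := fun z => by
    obtain ⟨C, h1, h2, h3⟩ := exists_finset_cover_pairs (F := auxClass h₀ δ M H) (N := N)
      (by rintro _ ⟨h, -, rfl⟩; exact h01 h) (ENat.natCast_toNat hfin).ge z
    exact ⟨C, h1, h2, fun τ => h3 _ ⟨p τ, hpH τ, rfl⟩⟩
  have hbad := (measure_exists_deviation_le P hn35 (t := t) (F := F)
    (fun τ => measurable_auxFun h₀ (p τ) hδ_meas M) fun τ => h01 (p τ)).trans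
    (mul_le_mul_right (measure_exists_mem_badDouble_le P hn35 ht1 (by linarith) hFm hcov) 3)
  set B := {s : Fin n → X × Y | ∃ τ, mean (fun i => F τ (s i)) +
    √(18 * (sumSqDev (fun i => F τ (s i)) / (n - 1)) * t / n) + 15 * t / (n - 1) <
      ∫ z, F τ z ∂P} with hB
  set Q := Measure.pi fun _ : Fin n => P with hQ
  have hBγ : Q B ≤ ENNReal.ofReal γ := by
    refine hbad.trans ?_
    have e3 : (3 : ℝ≥0∞) = ENNReal.ofReal 3 := by simp
    rw [hexp, e3, ← ENNReal.ofReal_mul (by norm_num)]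
    refine ENNReal.ofReal_le_ofReal ?_
    have : 3 * (N * (3 * (γ / (10 * N)))) = 9 / 10 * γ := by
      field_simp; norm_num
    rw [this]
    linarith
  -- The failure set `B` may be non-measurable; the event is the complement of a measurable hull of
  -- the same outer measure.
  refine ⟨(toMeasurable Q B)ᶜ, (measurableSet_toMeasurable _ _).compl, ?_, ?_⟩
  · rw [probReal_compl_eq_one_sub (measurableSet_toMeasurable _ _)]
    have : Q.real (toMeasurable Q B) ≤ γ := by
      rw [measureReal_def, measure_toMeasurable]
      exact ENNReal.toReal_le_of_le_ofReal hγ₀.le hBγ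
    linarith
  · intro s hs h hh
    have hsB : s ∉ B := fun h => hs (subset_toMeasurable _ _ h)
    simp only [hB, Set.mem_ofPred_eq, not_exists, not_lt] at hsB
    obtain ⟨τ, hτ⟩ := hlim h hh
    refine integral_auxFun_le_of_tendsto P h₀ h (g := fun k => p (τ k)) hδ_meas hδ hM
      (fun x y => ?_) s t fun k => hsB (τ k)
    simpa only [prob, hp] using hτ x y
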